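/- **Setting.** Let $n\ge 1$, $0\le r_{\inf}<r_{\sup}\le\infty$, and let $M=\{z\in\mathbb C^n : r_{\inf}<r<r_{\sup}\}$, where $r=|z_1|^2+\dots+|z_n|^2$. Let $f:(r_{\inf},r_{\sup})\to\mathbb R$ be smooth and such that $g_{i\bar j}=\partial_{z_i}\partial_{\bar z_j}f(r)$ is positive definite on $M$, so that $g$ is a (radial) Kähler metric with Kähler form $\omega=\frac i2\partial\bar\partial f(r)$. Let $\rho=-\frac i2\partial\bar\partial\log\det (g_{i\bar j})$ be its Ricci form, i.e. $\rho_{i\bar j}=-\partial_{z_i}\partial_{\bar z_j}\log\det g$. Assume that $g$ is a Kähler–Ricci soliton with solitonic constant $\lambda\in\mathbb R$: there is a holomorphic vector field $X$ on $M$ with $\rho=\lambda\omega+L_X\omega$, where $L_X$ is the Lie derivative along the real vector field $\sum_k X_k\partial_{z_k}+\bar X_k\partial_{\bar z_k}$. The soliton is called *trivial* if $g$ is Kähler–Einstein ($\rho=c\,\omega$ for a constant $c\in\mathbb R$). Put $y(r)=rf'(r)$ and $\psi(r)=ry'(r)$. Since $y$ is strictly increasing, $\psi$ may be regarded as a function $\psi(y)$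 of $y\in(y_{\inf},y_{\sup})=y\big((r_{\inf},r_{\sup})\big)$; a dot denotes $d/dy$. Call $f$ *maximal* if $y>0$ on $(r_{\inf},r_{\sup})$ and $f$ has no smooth extension to a strictly larger interval contained in $(0,\infty)$ that is again a potential of a Kähler metric with $y>0$. (For $n\ge2$ the condition $y>0$ is automatic.) Say that the soliton is *defined at the origin* if $r_{\inf}=0$ and $f$ extends smoothly to $[0,r_{\sup})$ as the radial potential of a Kähler metric on the ball $\{r<r_{\sup}\}$, origin included. **Proposition.** *Case $n=1$.* There exist $\mu,k\in\mathbb R$ such that on $(y_{\inf},y_{\sup})$ $$\dot\psi(y)=\mu\,\psi(y)+k+1-\lambda y. \tag{1}$$ Let $\mu,k$ be any real numbers satisfying (1). If $\mu=0$, then the soliton is trivial and $g$ has constant holomorphic sectional curvature. If $\mu\ne0$, then there is $\nu\in\mathbb R$ with $$\psi(y)=\nu e^{\mu y}+\frac{\lambda}{\mu}y+\Big(\frac{\lambda}{\mu^2}-\frac{k+1}{\mu}\Big),$$ the soliton is trivial iff $g$ is flat, $g$ has constant holomorphic sectional curvature iff it is flat, $g$ is flat iff $\nu=0$, and, if $f$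 is maximal, the soliton is defined at the origin iff $k=0$ and $\nu=\dfrac{\mu-\lambda}{\mu^2}$. *Case $n\ge2$.* There exists $\mu\in\mathbb R$ such that on $(y_{\inf},y_{\sup})$ $$\dot\psi(y)=\Big(\mu-\frac{n-1}{y}\Big)\psi(y)+n-\lambda y. \tag{2}$$ Let $\mu$ be any real number satisfying (2). If $\mu=0$, then the soliton is trivial. If $\mu\neq0$, then there is $\nu\in\mathbb R$ with $$\psi(y)=\frac{\nu e^{\mu y}}{y^{n-1}}+\frac{\lambda}{\mu}y+\frac{\lambda-\mu}{\mu^{n+1}}\sum_{j=0}^{n-1}\frac{n!}{j!}\mu^jy^{j+1-n},$$ the soliton is trivial iff $g$ is flat, $g$ is flat iff $\nu=0$ and $\mu=\lambda$, and, if $f$ is maximal, the soliton is defined at the origin iff $\nu=\dfrac{n!\,(\mu-\lambda)}{\mu^{n+1}}$. -/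

import Mathlib

open scoped ContDiff ComplexConjugate ComplexOrder

noncomputable section

namespace RadialKRS

/-- Complex coordinate space `ℂⁿ` (only its topology and its smooth structure are used). -/
abbrev Cn (n : ℕ) : Type := Fin n → ℂ

/-- The Wirtinger derivative `∂F/∂z_i`. -/
def dz {n : ℕ} (i : Fin n) (F : Cn n → ℂ) (z : Cn n) : ℂ :=
  (1 / 2 : ℂ) * (fderiv ℝ F z (Pi.single i 1) - Complex.I * fderiv ℝ F z (Pi.single i Complex.I))

/-- The Wirtinger derivative `∂F/∂z̄_i`. -/
def dzbar {n : ℕ} (i : Fin n) (F : Cn n → ℂ) (z : Cn n) : ℂ :=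
  (1 / 2 : ℂ) * (fderiv ℝ F z (Pi.single i 1) + Complex.I * fderiv ℝ F z (Pi.single i Complex.I))

/-- `r = |z_1|² + ⋯ + |z_n|²`. -/
def radius {n : ℕ} (z : Cn n) : ℝ := ∑ i, Complex.normSq (z i)

/-- The open interval `(a, b)` of the real line, where `b` may be `+∞`. -/
def interval (a : ℝ) (b : EReal) : Set ℝ := {x | a < x ∧ (x : EReal) < b}

/-- The rotation invariant domain `{z ∈ ℂⁿ : a < |z|² < b}`. -/
def shell (n : ℕ) (a : ℝ) (b : EReal) : Set (Cn n) := {z | radius z ∈ interval a b}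

/-! ### Kähler geometry in the coordinates `z_1, …, z_n`

A Hermitian metric is given by its matrix `g z i j = g_{i j̄}(z)`. -/

/-- The complex Hessian `∂²Φ/∂z_i ∂z̄_j` of a real function. -/
def complexHessian {n : ℕ} (Φ : Cn n → ℝ) (z : Cn n) : Matrix (Fin n) (Fin n) ℂ :=
  Matrix.of fun i j => dz i (dzbar j (fun w => (Φ w : ℂ))) z

/-- The matrix of the Ricci form, `ρ_{i j̄} = - ∂²(log det g)/∂z_i ∂z̄_j`. -/
def ricciMatrix {n : ℕ} (g : Cn n → Matrix (Fin n) (Fin n) ℂ) (z : Cn n) :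
    Matrix (Fin n) (Fin n) ℂ :=
  - complexHessian (fun w => Real.log (g w).det.re) z

/-- The two-form `(i/2) ∑ h_{i j̄} dz_i ∧ dz̄_j` with coefficient matrix `h`,
evaluated at the point `z` on the (real) tangent vectors `u, v ∈ ℂⁿ`. -/
def formOf {n : ℕ} (h : Cn n → Matrix (Fin n) (Fin n) ℂ) (z u v : Cn n) : ℂ :=
  (Complex.I / 2) * ∑ i, ∑ j, h z i j * (u i * conj (v j) - v i * conj (u j))

/-- The Lie derivative of a two-form along the vector field `X`, by
`(L_X β)(Y, Z) = X(β(Y, Z)) - β([X, Y], Z) - β(Y, [X, Z])`, evaluated at `z` on the tangent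
vectors `u, v`, which are extended to constant vector fields `Y, Z`.
A holomorphic map `X = (X_1, …, X_n)` stands for the real vector field
`∑ X_k ∂/∂z_k + X̄_k ∂/∂z̄_k`, whose value at `z` is the real tangent vector `X z ∈ ℂⁿ`. -/
def lieDerivative {n : ℕ} (X : Cn n → Cn n) (β : Cn n → Cn n → Cn n → ℂ) (z u v : Cn n) : ℂ :=
  fderiv ℝ (fun w => β w u v) z (X z)
    - β z (VectorField.lieBracket ℝ X (fun _ => u) z) v
    - β z u (VectorField.lieBracket ℝ X (fun _ => v) z)

/-- `(g, X)` is a Kähler-Ricci soliton on `U` with solitonic constant `lam`: the vector field `X`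
is holomorphic and `ρ = lam ω + L_X ω`. -/
def IsSoliton {n : ℕ} (g : Cn n → Matrix (Fin n) (Fin n) ℂ) (X : Cn n → Cn n) (lam : ℝ)
    (U : Set (Cn n)) : Prop :=
  DifferentiableOn ℂ X U ∧
  ∀ z ∈ U, ∀ u v : Cn n,
    formOf (ricciMatrix g) z u v = (lam : ℂ) * formOf g z u v + lieDerivative X (formOf g) z u v

/-- `g` is Kähler-Einstein on `U`; a Kähler-Ricci soliton is trivial if its metric is. -/
def IsKahlerEinstein {n : ℕ} (g : Cn n → Matrix (Fin n) (Fin n) ℂ) (U : Set (Cn n)) : Prop :=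
  ∃ c : ℝ, ∀ z ∈ U, ricciMatrix g z = (c : ℂ) • g z

/-- The curvature tensor of a Kähler metric,
`R_{i j̄ k l̄} = - ∂²g_{i j̄}/∂z_k ∂z̄_l + ∑_{p,q} (∂g_{i q̄}/∂z_k) g^{q̄ p} (∂g_{p j̄}/∂z̄_l)`. -/
def curvature {n : ℕ} (g : Cn n → Matrix (Fin n) (Fin n) ℂ) (z : Cn n) (i j k l : Fin n) : ℂ :=
  - dz k (dzbar l (fun w => g w i j)) z
    + ∑ p, ∑ q, dz k (fun w => g w i q) z * (g z)⁻¹ q p * dzbar l (fun w => g w p j) z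

/-- `g` is flat on `U`. -/
def IsFlat {n : ℕ} (g : Cn n → Matrix (Fin n) (Fin n) ℂ) (U : Set (Cn n)) : Prop :=
  ∀ z ∈ U, ∀ i j k l, curvature g z i j k l = 0

/-- `g` has constant holomorphic sectional curvature on `U`. -/
def IsComplexSpaceForm {n : ℕ} (g : Cn n → Matrix (Fin n) (Fin n) ℂ) (U : Set (Cn n)) : Prop :=
  ∃ c : ℝ, ∀ z ∈ U, ∀ v : Cn n,
    ∑ i, ∑ j, ∑ k, ∑ l, curvature g z i j k l * (v i * conj (v j) * v k * conj (v l))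
      = (c : ℂ) * (∑ i, ∑ j, g z i j * (v i * conj (v j))) ^ 2

/-! ### Radial metrics -/

/-- The metric `g_{i j̄} = ∂²f(|z|²)/∂z_i ∂z̄_j` with Kähler form `ω = (i/2) ∂∂̄ f(|z|²)`. -/
def radialMetric (n : ℕ) (f : ℝ → ℝ) : Cn n → Matrix (Fin n) (Fin n) ℂ :=
  complexHessian (fun w => f (radius w))

/-- `f` is a smooth radial potential of a Kähler metric on `{z ∈ ℂⁿ : a < |z|² < b}`,
where `0 ≤ a < b ≤ ∞`. -/
structure IsRadialKahlerPotential (n : ℕ) (f : ℝ → ℝ) (a : ℝ) (b : EReal) : Prop where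
  nonneg : 0 ≤ a
  lt : (a : EReal) < b
  smooth : ContDiffOn ℝ ∞ f (interval a b)
  posDef : ∀ z ∈ shell n a b, (radialMetric n f z).PosDef

/-- `y(r) = r f'(r)`. -/
def yFun (f : ℝ → ℝ) (r : ℝ) : ℝ := r * deriv f r

/-- `ψ(r) = r y'(r)`. -/
def psi (f : ℝ → ℝ) (r : ℝ) : ℝ := r * deriv (yFun f) r

/-- The set `(y_inf, y_sup)` of the values of `y(r)` for `r ∈ (a, b)`. -/
def yRange (f : ℝ → ℝ) (a : ℝ) (b : EReal) : Set ℝ := yFun f '' interval a b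

/-- `ψ` as a function of `y`: `ψ(y) = ψ(r(y))`, where `r(y)` is the inverse on `(y_inf, y_sup)` of
the function `y(r)`, `r ∈ (a, b)` (strictly increasing if `f` is a potential of a Kähler metric). -/
def psiOfY (f : ℝ → ℝ) (a : ℝ) (b : EReal) (s : ℝ) : ℝ :=
  psi f (Function.invFunOn (yFun f) (interval a b) s)

/-- `f` is a radial Kähler potential with `y(r) > 0` on `(a, b)`. If `n ≥ 2` then the positivity
of `y` follows from that of the metric; if `n = 1` then `f` is determined by the metric up to the
addition of `c log r + d`, and `y > 0` is a restriction on `c`. -/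
def IsPositiveRadialPotential (n : ℕ) (f : ℝ → ℝ) (a : ℝ) (b : EReal) : Prop :=
  IsRadialKahlerPotential n f a b ∧ ∀ r ∈ interval a b, 0 < yFun f r

/-- `(a, b)` is the maximal domain in `(0, ∞)` of the radial Kähler potential `f`, which has
`y > 0`. -/
def IsMaximalPotential (n : ℕ) (f : ℝ → ℝ) (a : ℝ) (b : EReal) : Prop :=
  IsPositiveRadialPotential n f a b ∧
  ∀ (F : ℝ → ℝ) (a' : ℝ) (b' : EReal), a' ≤ a → b ≤ b' →
    IsPositiveRadialPotential n F a' b' → Set.EqOn F f (interval a b) → a' = a ∧ b' = b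

/-- The metric with radial potential `f` on `(a, b)` is defined at the origin: `a = 0`, the
potential extends smoothly to `[0, b)`, and it is the potential of a metric on the whole ball
`{z ∈ ℂⁿ : |z|² < b}`. -/
def IsDefinedAtOrigin (n : ℕ) (f : ℝ → ℝ) (a : ℝ) (b : EReal) : Prop :=
  a = 0 ∧ ∃ F : ℝ → ℝ,
    ContDiffOn ℝ ∞ F {x | 0 ≤ x ∧ (x : EReal) < b} ∧
    Set.EqOn F f (interval a b) ∧
    ∀ z : Cn n, (radius z : EReal) < b → (radialMetric n F z).PosDef

end RadialKRS

end

/-! # Radial Kähler-Ricci solitons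

The metric of a radial potential `f` is `f' δ_{ij} + f'' z̄_i z_j`; its eigenvalues are `y' = ψ / r`
in the direction of `z` and `f' = y / r` orthogonally to `z`. So `log det g` is a function `L(r)`
(`logDet`), and the Ricci form is minus the complex Hessian of `L`.

*The differential equation.* On the complex line `ζ ↦ (ζ, 0, …, 0)` the soliton equation involves
the field `X` only through the real parts of the holomorphic functions `X_0/ζ`, `∂X_0/∂z_0` and
`∂X_m/∂z_m` (`IsSoliton.radial_eq`, `IsSoliton.transversal_eq`). All other terms depend on `r`
alone, so the equation may be averaged over the circles `|ζ|² = r`, and by Cauchy's theorem the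
averages of these functions are constants, the first two being equal (`IsSoliton.averaged_eq`). No
averaging of `X` over the unitary group is needed. The radial equation integrates to
`r L' + λ y + 2 c ψ = k`, which is the equation for `ψ` with `μ = -2c`; in dimension at least two the
transversal equation gives `k = 2 (c - e) y`, hence `k = 0` (`IsSoliton.exists_integrated`). The
equation for `yⁿ⁻¹ ψ` is linear, so that its solutions differ by multiples of `e^{μ y}`.

*Triviality.* In dimension one the Gaussian curvature is, up to a constant factor, `λ - μ dψ/dy`.
This is `λ` if `μ = 0`; otherwise it is `-μ² ν e^{μ y}`, which is constant only for `ν = 0`. In higher dimension `-2 f''` is a component of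
the curvature, so flatness means `f'' = 0`, i.e. `ψ = y`. A Kähler-Einstein soliton with `μ ≠ 0` has
`ψ = α y`, and the differential equation forces `α = 1`.

*The origin.* If the metric is defined at the origin then `y` and `ψ` tend to `0` with `r`, so that
`Q(y) = yⁿ⁻¹ ψ(y)`, an entire function, vanishes at `y = 0`; this is the condition on `ν`. In
dimension one `dψ/dy` tends to `1`, which gives `k = 0`. Conversely, if `Q(0) = 0` then the linear equation
`Q' = μ Q + (n - λ y) yⁿ⁻¹` shows that `Q = yⁿ (1 + y κ(y))` with `κ` analytic
(`exists_factor_of_ode`), and that `Q > 0` on the whole interval from `0` to any value of `y`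
(`pos_of_ode`). Hence `r y' = ψ(y)` can be solved by separation of variables down to `r = 0` and
smoothly beyond it (`exists_extension`), and maximality gives `r_inf = 0`.
-/

namespace RadialKRS

/-! ### The complex Hessian of a radial function -/

/-- The real differential of `radius` at `z`, the map `u ↦ 2 Re ∑ u_i z̄_i`. -/
noncomputable def radiusDeriv {n : ℕ} (z : Cn n) : Cn n →L[ℝ] ℝ :=
  ∑ i, ((2 * (z i).re) • (Complex.reCLM.comp (ContinuousLinearMap.proj (R := ℝ) i))
    + (2 * (z i).im) • (Complex.imCLM.comp (ContinuousLinearMap.proj (R := ℝ) i)))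

lemma radiusDeriv_apply {n : ℕ} (z u : Cn n) :
    radiusDeriv z u = ∑ i, (2 * (z i).re * (u i).re + 2 * (z i).im * (u i).im) := by
  simp [radiusDeriv]

lemma radiusDeriv_single {n : ℕ} (z : Cn n) (i : Fin n) (c : ℂ) :
    radiusDeriv z (Pi.single i c) = 2 * (z i).re * c.re + 2 * (z i).im * c.im := by
  rw [radiusDeriv_apply, Finset.sum_eq_single i]
  · simp
  · intro j _ hj
    simp [hj]
  · simp

lemma hasFDerivAt_radius {n : ℕ} (z : Cn n) : HasFDerivAt (radius (n := n)) (radiusDeriv z) z := by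
  have hre : ∀ i : Fin n, HasFDerivAt (fun w : Cn n => (w i).re)
      (Complex.reCLM.comp (ContinuousLinearMap.proj (R := ℝ) (φ := fun _ : Fin n => ℂ) i)) z :=
    fun i => (Complex.reCLM.comp (ContinuousLinearMap.proj (R := ℝ)
      (φ := fun _ : Fin n => ℂ) i)).hasFDerivAt
  have him : ∀ i : Fin n, HasFDerivAt (fun w : Cn n => (w i).im)
      (Complex.imCLM.comp (ContinuousLinearMap.proj (R := ℝ) (φ := fun _ : Fin n => ℂ) i)) z :=
    fun i => (Complex.imCLM.comp (ContinuousLinearMap.proj (R := ℝ)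
      (φ := fun _ : Fin n => ℂ) i)).hasFDerivAt
  have h : HasFDerivAt (fun w : Cn n => ∑ i, Complex.normSq (w i)) (radiusDeriv z) z := by
    refine HasFDerivAt.fun_sum fun i _ => ?_
    have h2 := ((hre i).mul (hre i)).add ((him i).mul (him i))
    refine (h2.congr_fderiv ?_)
    ext u
    simp
    ring
  exact h

lemma continuous_radius {n : ℕ} : Continuous (radius (n := n)) :=
  continuous_iff_continuousAt.2 fun z => (hasFDerivAt_radius z).continuousAt

lemma radius_nonneg {n : ℕ} (z : Cn n) : 0 ≤ radius z :=
  Finset.sum_nonneg fun _ _ => Complex.normSq_nonneg _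

lemma radius_single {n : ℕ} (i : Fin n) (c : ℂ) :
    radius (Pi.single i c : Cn n) = Complex.normSq c := by
  rw [radius, Finset.sum_eq_single i]
  · simp
  · intro j _ hj
    simp [hj]
  · simp

/-- Chain rule for `φ(|w|²)`. The derivative of `φ` is taken within a set `S` containing the values
of `|w|²` near `z`, so that potentials which are smooth only up to `|w|² = 0` are covered. -/
lemma hasFDerivAt_comp_radius {n : ℕ} {φ : ℝ → ℝ} {d : ℝ} {S : Set ℝ} {z : Cn n}
    (hS : ∀ᶠ w in nhds z, radius w ∈ S) (h : HasDerivWithinAt φ d S (radius z)) :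
    HasFDerivAt (fun w : Cn n => φ (radius w)) (d • radiusDeriv z) z := by
  have h1 := h.comp_hasFDerivWithinAt (s := radius ⁻¹' S) z
    (hasFDerivAt_radius z).hasFDerivWithinAt (fun w hw => hw)
  exact h1.hasFDerivAt hS

lemma hasFDerivAt_ofReal_comp_radius {n : ℕ} {φ : ℝ → ℝ} {d : ℝ} {S : Set ℝ} {z : Cn n}
    (hS : ∀ᶠ w in nhds z, radius w ∈ S) (h : HasDerivWithinAt φ d S (radius z)) :
    HasFDerivAt (fun w : Cn n => (φ (radius w) : ℂ))
      (Complex.ofRealCLM.comp (d • radiusDeriv z)) z :=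
  Complex.ofRealCLM.hasFDerivAt.comp z (hasFDerivAt_comp_radius hS h)

lemma dz_of_hasFDerivAt {n : ℕ} {F : Cn n → ℂ} {L : Cn n →L[ℝ] ℂ} {z : Cn n}
    (h : HasFDerivAt F L z) (i : Fin n) :
    dz i F z = (1 / 2 : ℂ) * (L (Pi.single i 1) - Complex.I * L (Pi.single i Complex.I)) := by
  rw [dz, h.fderiv]

lemma dzbar_of_hasFDerivAt {n : ℕ} {F : Cn n → ℂ} {L : Cn n →L[ℝ] ℂ} {z : Cn n}
    (h : HasFDerivAt F L z) (i : Fin n) :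
    dzbar i F z = (1 / 2 : ℂ) * (L (Pi.single i 1) + Complex.I * L (Pi.single i Complex.I)) := by
  rw [dzbar, h.fderiv]

lemma dzbar_congr {n : ℕ} {F G : Cn n → ℂ} {z : Cn n} (h : F =ᶠ[nhds z] G) (i : Fin n) :
    dzbar i F z = dzbar i G z := by
  rw [dzbar, dzbar, h.fderiv_eq]

lemma dz_congr {n : ℕ} {F G : Cn n → ℂ} {z : Cn n} (h : F =ᶠ[nhds z] G) (i : Fin n) :
    dz i F z = dz i G z := by
  rw [dz, dz, h.fderiv_eq]

lemma dz_dzbar_congr {n : ℕ} {F G : Cn n → ℂ} {z : Cn n} (h : F =ᶠ[nhds z] G) (i j : Fin n) :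
    dz i (dzbar j F) z = dz i (dzbar j G) z :=
  dz_congr (h.eventuallyEq_nhds.mono fun _ hw => dzbar_congr hw j) i

lemma complexHessian_congr {n : ℕ} {Φ Ψ : Cn n → ℝ} {z : Cn n} (h : Φ =ᶠ[nhds z] Ψ) :
    complexHessian Φ z = complexHessian Ψ z := by
  ext i j
  simp only [complexHessian, Matrix.of_apply]
  exact dz_dzbar_congr (h.mono fun w hw => by simp [hw]) i j

lemma dzbar_comp_radius {n : ℕ} {φ : ℝ → ℝ} {d : ℝ} {S : Set ℝ} {z : Cn n}
    (hS : ∀ᶠ w in nhds z, radius w ∈ S) (h : HasDerivWithinAt φ d S (radius z)) (j : Fin n) :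
    dzbar j (fun w : Cn n => (φ (radius w) : ℂ)) z = d * z j := by
  rw [dzbar_of_hasFDerivAt (hasFDerivAt_ofReal_comp_radius hS h)]
  simp only [ContinuousLinearMap.comp_apply, smul_apply, radiusDeriv_single]
  apply Complex.ext <;> simp <;> ring

lemma dz_comp_radius {n : ℕ} {φ : ℝ → ℝ} {d : ℝ} {S : Set ℝ} {z : Cn n}
    (hS : ∀ᶠ w in nhds z, radius w ∈ S) (h : HasDerivWithinAt φ d S (radius z)) (i : Fin n) :
    dz i (fun w : Cn n => (φ (radius w) : ℂ)) z = d * conj (z i) := by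
  rw [dz_of_hasFDerivAt (hasFDerivAt_ofReal_comp_radius hS h)]
  simp only [ContinuousLinearMap.comp_apply, smul_apply, radiusDeriv_single]
  apply Complex.ext <;> simp <;> ring

lemma hasFDerivAt_coord {n : ℕ} (j : Fin n) (z : Cn n) :
    HasFDerivAt (fun w : Cn n => w j)
      (ContinuousLinearMap.proj (R := ℝ) (φ := fun _ : Fin n => ℂ) j) z :=
  (ContinuousLinearMap.proj (R := ℝ) (φ := fun _ : Fin n => ℂ) j).hasFDerivAt

lemma dz_comp_radius_mul_coord {n : ℕ} {φ : ℝ → ℝ} {d : ℝ} {S : Set ℝ} {z : Cn n}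
    (hS : ∀ᶠ w in nhds z, radius w ∈ S) (h : HasDerivWithinAt φ d S (radius z)) (i j : Fin n) :
    dz i (fun w : Cn n => (φ (radius w) : ℂ) * w j) z
      = (φ (radius z) : ℂ) * (if i = j then 1 else 0) + d * (conj (z i) * z j) := by
  have hmul : HasFDerivAt (fun w : Cn n => (φ (radius w) : ℂ) * w j) _ z :=
    (hasFDerivAt_ofReal_comp_radius hS h).mul (hasFDerivAt_coord j z)
  rw [dz_of_hasFDerivAt hmul]
  simp only [ContinuousLinearMap.comp_apply, smul_apply, radiusDeriv_single,
    add_apply, ContinuousLinearMap.proj_apply, Pi.single_apply]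
  by_cases hij : i = j
  · subst hij
    apply Complex.ext <;> simp <;> ring
  · have hji : ¬ j = i := fun h => hij h.symm
    simp only [if_neg hij, if_neg hji]
    apply Complex.ext <;> simp <;> ring

/-- `∂²φ(|z|²)/∂z_i∂z̄_j = φ' δ_{ij} + φ'' z̄_i z_j`. -/
lemma complexHessian_radial {n : ℕ} {φ φ₁ : ℝ → ℝ} {d : ℝ} {S : Set ℝ} {z : Cn n}
    (hS : ∀ᶠ w in nhds z, radius w ∈ S) (h : ∀ x ∈ S, HasDerivWithinAt φ (φ₁ x) S x)
    (h₁ : HasDerivWithinAt φ₁ d S (radius z)) (i j : Fin n) :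
    complexHessian (fun w : Cn n => φ (radius w)) z i j
      = (φ₁ (radius z) : ℂ) * (if i = j then 1 else 0) + d * (conj (z i) * z j) := by
  simp only [complexHessian, Matrix.of_apply]
  rw [← dz_comp_radius_mul_coord hS h₁]
  refine dz_congr ?_ i
  filter_upwards [hS.eventually_nhds] with w hw
  exact dzbar_comp_radius hw (h _ hw.self_of_nhds) j

/-- The Hermitian form `α |x|² + β |⟨x, z⟩|²` is positive definite if `α > 0` and
`α + β |z|² > 0`: by Cauchy-Schwarz its value lies between `α |x|²` and `(α + β |z|²) |x|²`. -/
lemma posDef_of_radial {n : ℕ} {g : Matrix (Fin n) (Fin n) ℂ} {z : Cn n} {α β : ℝ}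
    (hg : ∀ i j, g i j = (α : ℂ) * (if i = j then 1 else 0) + β * (conj (z i) * z j))
    (hα : 0 < α) (hβ : 0 < α + radius z * β) : g.PosDef := by
  have hherm : g.IsHermitian := by
    ext i j
    rw [Matrix.conjTranspose_apply, hg, hg]
    by_cases hij : i = j
    · subst hij
      simp [mul_comm]
    · have hji : ¬ j = i := fun h => hij h.symm
      simp [hij, hji, mul_comm]
  refine Matrix.PosDef.of_dotProduct_mulVec_pos hherm fun x hx => ?_
  set s : ℂ := ∑ j, z j * x j with hs
  have hval : star x ⬝ᵥ (g.mulVec x) = ((α * radius x + β * Complex.normSq s : ℝ) : ℂ) := by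
    have h1 : ∀ i, g.mulVec x i = α * x i + β * conj (z i) * s := by
      intro i
      simp only [Matrix.mulVec, dotProduct, hg, hs, Finset.mul_sum, add_mul,
        Finset.sum_add_distrib]
      congr 1
      · rw [Finset.sum_eq_single i]
        · simp
        · intro j _ hj
          simp [hj.symm]
        · simp
      · exact Finset.sum_congr rfl fun j _ => by ring
    have h2 : conj s = ∑ j, conj (z j) * conj (x j) := by simp [hs]
    simp only [dotProduct, h1, Pi.star_apply]
    have h3 : ∀ i, star (x i) * (α * x i + β * conj (z i) * s)
        = α * (Complex.normSq (x i) : ℂ) + β * s * (conj (z i) * conj (x i)) := by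
      intro i
      rw [Complex.normSq_eq_conj_mul_self]
      simp only [RCLike.star_def]
      ring
    rw [Finset.sum_congr rfl fun i _ => h3 i, Finset.sum_add_distrib, ← Finset.mul_sum,
      ← Finset.mul_sum, ← h2]
    simp only [radius]
    push_cast
    rw [Complex.normSq_eq_conj_mul_self]
    ring
  rw [hval]
  have hxr : 0 < radius x := by
    obtain ⟨i, hi⟩ := Function.ne_iff.1 hx
    exact Finset.sum_pos' (fun _ _ => Complex.normSq_nonneg _)
      ⟨i, Finset.mem_univ _, Complex.normSq_pos.2 hi⟩
  have hcs : Complex.normSq s ≤ radius z * radius x := by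
    have h1 : ‖s‖ ≤ ∑ j, ‖z j‖ * ‖x j‖ :=
      (norm_sum_le _ _).trans (le_of_eq (Finset.sum_congr rfl fun j _ => norm_mul _ _))
    have h2 := Finset.sum_mul_sq_le_sq_mul_sq Finset.univ (fun j => ‖z j‖) (fun j => ‖x j‖)
    simp only [radius, Complex.normSq_eq_norm_sq]
    exact (pow_le_pow_left₀ (norm_nonneg _) h1 2).trans h2
  have hs0 : 0 ≤ Complex.normSq s := Complex.normSq_nonneg _
  have : 0 < α * radius x + β * Complex.normSq s := by
    rcases le_or_gt 0 β with hb | hb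
    · positivity
    · nlinarith [mul_pos hβ hxr, mul_le_mul_of_nonneg_left hcs (neg_nonneg.2 hb.le)]
  exact_mod_cast this

/-- The matrix `α δ_{ij} + β z̄_i z_j` has the eigenvalue `α + β |z|²` once and `α` otherwise. -/
lemma det_radial {n : ℕ} (hn : 1 ≤ n) {g : Matrix (Fin n) (Fin n) ℂ} {z : Cn n} {α β : ℝ}
    (hg : ∀ i j, g i j = (α : ℂ) * (if i = j then 1 else 0) + β * (conj (z i) * z j))
    (hα : n = 1 ∨ α ≠ 0) :
    g.det = ((α ^ (n - 1) * (α + radius z * β) : ℝ) : ℂ) := by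
  have hr : (radius z : ℂ) = ∑ i, z i * conj (z i) := by
    simp [radius, Complex.mul_conj]
  by_cases h0 : α = 0
  · obtain rfl : n = 1 := by tauto
    rw [Matrix.det_fin_one, hg]
    push_cast
    rw [hr]
    simp
    ring
  · have hg' : g = (α : ℂ) • (1 + Matrix.replicateCol Unit (fun i => (β / α : ℂ) * conj (z i)) *
        Matrix.replicateRow Unit z) := by
      ext i j
      rw [hg]
      have : (α : ℂ) ≠ 0 := by exact_mod_cast h0
      simp only [Matrix.smul_apply, Matrix.add_apply, Matrix.one_apply, Matrix.mul_apply,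
        Matrix.replicateCol_apply, Matrix.replicateRow_apply, Finset.univ_unique,
        Finset.sum_singleton, smul_eq_mul]
      field_simp
    have hα' : (α : ℂ) ≠ 0 := by exact_mod_cast h0
    rw [hg', Matrix.det_smul, Matrix.det_one_add_replicateCol_mul_replicateRow]
    obtain ⟨m, rfl⟩ : ∃ m, n = m + 1 := ⟨n - 1, by omega⟩
    have h2 : z ⬝ᵥ (fun i => (β / α : ℂ) * conj (z i)) = (β / α : ℂ) * radius z := by
      rw [hr, Finset.mul_sum]
      exact Finset.sum_congr rfl fun i _ => by ring
    rw [h2]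
    simp only [Fintype.card_fin, Nat.add_sub_cancel]
    push_cast
    field_simp
    ring

/-! ### The profile of a radial Kähler metric -/

lemma isOpen_interval (a : ℝ) (b : EReal) : IsOpen (interval a b) :=
  (isOpen_lt continuous_const continuous_id).inter
    (isOpen_lt continuous_coe_real_ereal continuous_const)

lemma ordConnected_interval (a : ℝ) (b : EReal) : (interval a b).OrdConnected :=
  ⟨fun _ hx _ hy _ hz => ⟨hx.1.trans_le hz.1, (EReal.coe_le_coe_iff.2 hz.2).trans_lt hy.2⟩⟩

lemma isPreconnected_interval (a : ℝ) (b : EReal) : IsPreconnected (interval a b) :=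
  (ordConnected_interval a b).isPreconnected

lemma isOpen_shell (n : ℕ) (a : ℝ) (b : EReal) : IsOpen (shell n a b) :=
  (isOpen_interval a b).preimage continuous_radius

lemma eventually_radius_mem {n : ℕ} {a : ℝ} {b : EReal} {z : Cn n} (hz : z ∈ shell n a b) :
    ∀ᶠ w in nhds z, radius w ∈ interval a b :=
  (isOpen_shell n a b).mem_nhds hz

lemma exists_lt_mem_interval {a : ℝ} {b : EReal} {r : ℝ} (hr : r ∈ interval a b) :
    ∃ s ∈ interval a b, r < s := by
  obtain ⟨ε, hε, h⟩ := Metric.isOpen_iff.1 (isOpen_interval a b) r hr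
  refine ⟨r + ε / 2, h ?_, by linarith⟩
  rw [Metric.mem_ball, Real.dist_eq, add_sub_cancel_left, abs_of_pos (half_pos hε)]
  linarith

lemma nonempty_interval {a : ℝ} {b : EReal} (h : (a : EReal) < b) : (interval a b).Nonempty := by
  obtain ⟨c, h1, h2⟩ := EReal.lt_iff_exists_real_btwn.1 h
  exact ⟨c, EReal.coe_lt_coe_iff.1 h1, h2⟩

lemma _root_.ContDiffOn.deriv_interval {g : ℝ → ℝ} {a : ℝ} {b : EReal}
    (h : ContDiffOn ℝ ∞ g (interval a b)) : ContDiffOn ℝ ∞ (deriv g) (interval a b) :=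
  h.deriv_of_isOpen (isOpen_interval a b) (by simp)

lemma _root_.ContDiffOn.hasDerivAt_interval {g : ℝ → ℝ} {a : ℝ} {b : EReal}
    (h : ContDiffOn ℝ ∞ g (interval a b)) {r : ℝ} (hr : r ∈ interval a b) :
    HasDerivAt g (deriv g r) r :=
  ((h.contDiffAt ((isOpen_interval a b).mem_nhds hr)).differentiableAt (by simp)).hasDerivAt

lemma complexHessian_radial_of_mem {n : ℕ} {φ : ℝ → ℝ} {a : ℝ} {b : EReal}
    (h : ContDiffOn ℝ ∞ φ (interval a b)) {z : Cn n} (hz : z ∈ shell n a b) (i j : Fin n) :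
    complexHessian (fun w : Cn n => φ (radius w)) z i j
      = ((deriv φ (radius z) : ℝ) : ℂ) * (if i = j then 1 else 0)
        + ((deriv (deriv φ) (radius z) : ℝ) : ℂ) * (conj (z i) * z j) :=
  complexHessian_radial (eventually_radius_mem hz)
    (fun _ hx => (h.hasDerivAt_interval hx).hasDerivWithinAt)
    (h.deriv_interval.hasDerivAt_interval hz).hasDerivWithinAt i j

/-- The point `(ζ, 0, …, 0)`. -/
noncomputable def axisPoint (n : ℕ) [NeZero n] (ζ : ℂ) : Cn n := Pi.single 0 ζ

lemma axisPoint_mem {n : ℕ} [NeZero n] {a : ℝ} {b : EReal} {ζ : ℂ}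
    (h : Complex.normSq ζ ∈ interval a b) : axisPoint n ζ ∈ shell n a b := by
  simpa [shell, axisPoint, radius_single] using h

lemma radius_axisPoint {n : ℕ} [NeZero n] (ζ : ℂ) : radius (axisPoint n ζ) = Complex.normSq ζ :=
  radius_single _ _

lemma normSq_sqrt {r : ℝ} (hr : 0 ≤ r) : Complex.normSq (Real.sqrt r : ℂ) = r := by
  rw [Complex.normSq_ofReal, Real.mul_self_sqrt hr]

section Profile

variable {n : ℕ} {f : ℝ → ℝ} {a : ℝ} {b : EReal}

lemma IsRadialKahlerPotential.pos (hf : IsRadialKahlerPotential n f a b) {r : ℝ}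
    (hr : r ∈ interval a b) : 0 < r := hf.nonneg.trans_lt hr.1

lemma radialMetric_apply (hf : ContDiffOn ℝ ∞ f (interval a b)) {z : Cn n}
    (hz : z ∈ shell n a b) (i j : Fin n) :
    radialMetric n f z i j = ((deriv f (radius z) : ℝ) : ℂ) * (if i = j then 1 else 0)
        + ((deriv (deriv f) (radius z) : ℝ) : ℂ) * (conj (z i) * z j) :=
  complexHessian_radial_of_mem hf hz i j

lemma contDiffOn_yFun (hf : ContDiffOn ℝ ∞ f (interval a b)) :
    ContDiffOn ℝ ∞ (yFun f) (interval a b) :=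
  contDiffOn_id.mul hf.deriv_interval

lemma contDiffOn_psi (hf : ContDiffOn ℝ ∞ f (interval a b)) :
    ContDiffOn ℝ ∞ (psi f) (interval a b) :=
  contDiffOn_id.mul (contDiffOn_yFun hf).deriv_interval

lemma deriv_yFun (hf : ContDiffOn ℝ ∞ f (interval a b)) {r : ℝ} (hr : r ∈ interval a b) :
    deriv (yFun f) r = deriv f r + r * deriv (deriv f) r := by
  have h : HasDerivAt (yFun f) _ r :=
    (hasDerivAt_id r).mul (hf.deriv_interval.hasDerivAt_interval hr)
  simpa using h.deriv

lemma deriv_deriv_yFun (hf : ContDiffOn ℝ ∞ f (interval a b)) {r : ℝ} (hr : r ∈ interval a b) :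
    deriv (deriv (yFun f)) r = 2 * deriv (deriv f) r + r * deriv (deriv (deriv f)) r := by
  have h1 : deriv (yFun f) =ᶠ[nhds r] fun r => deriv f r + r * deriv (deriv f) r :=
    Filter.eventually_of_mem ((isOpen_interval a b).mem_nhds hr) fun x hx => deriv_yFun hf hx
  have h2 := (hf.deriv_interval.hasDerivAt_interval hr).add
    ((hasDerivAt_id r).mul (hf.deriv_interval.deriv_interval.hasDerivAt_interval hr))
  rw [h1.deriv_eq]
  refine HasDerivAt.deriv (f' := _) (h2.congr_deriv ?_)
  simp
  ring

lemma deriv_psi (hf : ContDiffOn ℝ ∞ f (interval a b)) {r : ℝ} (hr : r ∈ interval a b) :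
    deriv (psi f) r = deriv (yFun f) r + r * deriv (deriv (yFun f)) r := by
  have h : HasDerivAt (psi f) _ r :=
    (hasDerivAt_id r).mul ((contDiffOn_yFun hf).deriv_interval.hasDerivAt_interval hr)
  simpa using h.deriv

/-- The eigenvalue of the metric in the radial direction is `y'`. -/
lemma deriv_yFun_pos (hn : 1 ≤ n) (hf : IsRadialKahlerPotential n f a b) {r : ℝ}
    (hr : r ∈ interval a b) : 0 < deriv (yFun f) r := by
  have : NeZero n := ⟨by omega⟩
  have hr0 := hf.pos hr
  have hz : axisPoint n (Real.sqrt r : ℂ) ∈ shell n a b :=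
    axisPoint_mem (by rwa [normSq_sqrt hr0.le])
  have h := (hf.posDef _ hz).diag_pos (i := 0)
  rw [radialMetric_apply hf.smooth hz, radius_axisPoint, normSq_sqrt hr0.le] at h
  rw [deriv_yFun hf.smooth hr]
  have h2 : ((Real.sqrt r : ℂ)) * (Real.sqrt r : ℂ) = (r : ℂ) := by
    exact_mod_cast Real.mul_self_sqrt hr0.le
  simp only [axisPoint, Pi.single_eq_same, Complex.conj_ofReal, if_true, mul_one, h2] at h
  have h3 : (0 : ℂ) < ((deriv f r + r * deriv (deriv f) r : ℝ) : ℂ) := by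
    convert h using 1
    push_cast
    ring
  exact_mod_cast h3

/-- The eigenvalue of the metric in the directions orthogonal to `z` is `f'`. -/
lemma deriv_pos (hn : 2 ≤ n) (hf : IsRadialKahlerPotential n f a b) {r : ℝ}
    (hr : r ∈ interval a b) : 0 < deriv f r := by
  have : NeZero n := ⟨by omega⟩
  have hr0 := hf.pos hr
  have hz : axisPoint n (Real.sqrt r : ℂ) ∈ shell n a b :=
    axisPoint_mem (by rwa [normSq_sqrt hr0.le])
  have h := (hf.posDef _ hz).diag_pos (i := ⟨1, by omega⟩)
  rw [radialMetric_apply hf.smooth hz, radius_axisPoint, normSq_sqrt hr0.le] at h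
  have h1 : axisPoint n (Real.sqrt r : ℂ) ⟨1, by omega⟩ = 0 :=
    Pi.single_eq_of_ne (by simp [Fin.ext_iff]) _
  simpa [h1] using h

lemma yFun_pos (hn : 2 ≤ n) (hf : IsRadialKahlerPotential n f a b) {r : ℝ}
    (hr : r ∈ interval a b) : 0 < yFun f r :=
  mul_pos (hf.pos hr) (deriv_pos hn hf hr)

lemma psi_pos (hn : 1 ≤ n) (hf : IsRadialKahlerPotential n f a b) {r : ℝ}
    (hr : r ∈ interval a b) : 0 < psi f r :=
  mul_pos (hf.pos hr) (deriv_yFun_pos hn hf hr)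

lemma strictMonoOn_yFun (hn : 1 ≤ n) (hf : IsRadialKahlerPotential n f a b) :
    StrictMonoOn (yFun f) (interval a b) := by
  refine strictMonoOn_of_deriv_pos (ordConnected_interval a b).convex
    (contDiffOn_yFun hf.smooth).continuousOn fun x hx => ?_
  rw [(isOpen_interval a b).interior_eq] at hx
  exact deriv_yFun_pos hn hf hx

lemma not_const_yFun (hn : 1 ≤ n) (hf : IsRadialKahlerPotential n f a b) :
    ∃ r ∈ interval a b, ∃ s ∈ interval a b, yFun f r < yFun f s := by
  obtain ⟨r, hr⟩ := nonempty_interval hf.lt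
  obtain ⟨s, hs, hrs⟩ := exists_lt_mem_interval hr
  exact ⟨r, hr, s, hs, strictMonoOn_yFun hn hf hr hs hrs⟩

lemma isOpen_yRange (hn : 1 ≤ n) (hf : IsRadialKahlerPotential n f a b) :
    IsOpen (yRange f a b) := by
  rw [isOpen_iff_mem_nhds]
  rintro _ ⟨r, hr, rfl⟩
  have h1 : HasStrictDerivAt (yFun f) (deriv (yFun f) r) r :=
    ((contDiffOn_yFun hf.smooth).contDiffAt ((isOpen_interval a b).mem_nhds hr)).hasStrictDerivAt
      (by simp)
  rw [← h1.map_nhds_eq (deriv_yFun_pos hn hf hr).ne']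
  exact Filter.image_mem_map ((isOpen_interval a b).mem_nhds hr)

lemma ordConnected_yRange (hf : IsRadialKahlerPotential n f a b) : (yRange f a b).OrdConnected :=
  ((isPreconnected_interval a b).image _ (contDiffOn_yFun hf.smooth).continuousOn).ordConnected

lemma invFunOn_yFun (hn : 1 ≤ n) (hf : IsRadialKahlerPotential n f a b) {r : ℝ}
    (hr : r ∈ interval a b) : Function.invFunOn (yFun f) (interval a b) (yFun f r) = r :=
  (strictMonoOn_yFun hn hf).injOn.leftInvOn_invFunOn hr

lemma psiOfY_yFun (hn : 1 ≤ n) (hf : IsRadialKahlerPotential n f a b) {r : ℝ}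
    (hr : r ∈ interval a b) : psiOfY f a b (yFun f r) = psi f r := by
  rw [psiOfY, invFunOn_yFun hn hf hr]

/-- `d/dy = (1/y') d/dr`. -/
lemma hasDerivAt_psiOfY (hn : 1 ≤ n) (hf : IsRadialKahlerPotential n f a b) {r : ℝ}
    (hr : r ∈ interval a b) :
    HasDerivAt (psiOfY f a b) (deriv (psi f) r / deriv (yFun f) r) (yFun f r) := by
  have h1 : HasStrictDerivAt (yFun f) (deriv (yFun f) r) r :=
    ((contDiffOn_yFun hf.smooth).contDiffAt ((isOpen_interval a b).mem_nhds hr)).hasStrictDerivAt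
      (by simp)
  have hne := (deriv_yFun_pos hn hf hr).ne'
  have h2 : HasStrictDerivAt (Function.invFunOn (yFun f) (interval a b)) (deriv (yFun f) r)⁻¹
      (yFun f r) :=
    h1.to_local_left_inverse hne (Filter.eventually_of_mem ((isOpen_interval a b).mem_nhds hr)
      fun x hx => invFunOn_yFun hn hf hx)
  have h3 := (contDiffOn_psi hf.smooth).hasDerivAt_interval hr
  rw [← invFunOn_yFun hn hf hr] at h3
  have h4 := h3.comp _ h2.hasDerivAt
  rw [invFunOn_yFun hn hf hr] at h4
  exact h4

/-- An equation `dψ/dy = q` at `y(r)` amounts to `dψ/dr = q dy/dr` at `r`. -/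
lemma hasDerivAt_psiOfY_iff (hn : 1 ≤ n) (hf : IsRadialKahlerPotential n f a b) {r q : ℝ}
    (hr : r ∈ interval a b) :
    HasDerivAt (psiOfY f a b) q (yFun f r) ↔ deriv (psi f) r = q * deriv (yFun f) r := by
  have h := hasDerivAt_psiOfY hn hf hr
  have hne := (deriv_yFun_pos hn hf hr).ne'
  rw [← div_eq_iff hne]
  exact ⟨fun h' => h.unique h', fun h' => h' ▸ h⟩

/-! ### The Ricci form of a radial metric -/

/-- `log det g` as a function of `r`. -/
noncomputable def logDet (n : ℕ) (f : ℝ → ℝ) (r : ℝ) : ℝ :=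
  Real.log (deriv f r ^ (n - 1) * deriv (yFun f) r)

/-- The power `f'ⁿ⁻¹` in the determinant does not vanish (in dimension one it is `1`, and `f'` may
have any sign). -/
lemma eq_one_or_deriv_ne_zero (hn : 1 ≤ n) (hf : IsRadialKahlerPotential n f a b) {r : ℝ}
    (hr : r ∈ interval a b) : n = 1 ∨ deriv f r ≠ 0 := by
  rcases Nat.lt_or_ge n 2 with h | h
  · exact Or.inl (by omega)
  · exact Or.inr (deriv_pos h hf hr).ne'

lemma pow_deriv_ne_zero (hn : 1 ≤ n) (hf : IsRadialKahlerPotential n f a b) {r : ℝ}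
    (hr : r ∈ interval a b) : deriv f r ^ (n - 1) ≠ 0 := by
  rcases eq_one_or_deriv_ne_zero hn hf hr with h | h
  · simp [h]
  · exact pow_ne_zero _ h

lemma contDiffOn_logDet (hn : 1 ≤ n) (hf : IsRadialKahlerPotential n f a b) :
    ContDiffOn ℝ ∞ (logDet n f) (interval a b) :=
  ((hf.smooth.deriv_interval.pow _).mul (contDiffOn_yFun hf.smooth).deriv_interval).log
    fun _ hr => mul_ne_zero (pow_deriv_ne_zero hn hf hr) (deriv_yFun_pos hn hf hr).ne'

lemma log_det_radialMetric (hn : 1 ≤ n) (hf : IsRadialKahlerPotential n f a b) {z : Cn n}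
    (hz : z ∈ shell n a b) :
    Real.log (radialMetric n f z).det.re = logDet n f (radius z) := by
  rw [det_radial hn (radialMetric_apply hf.smooth hz) (eq_one_or_deriv_ne_zero hn hf hz), logDet,
    deriv_yFun hf.smooth hz, Complex.ofReal_re]

lemma ricciMatrix_radial (hn : 1 ≤ n) (hf : IsRadialKahlerPotential n f a b) {z : Cn n}
    (hz : z ∈ shell n a b) (i j : Fin n) :
    ricciMatrix (radialMetric n f) z i j
      = -(((deriv (logDet n f) (radius z) : ℝ) : ℂ) * (if i = j then 1 else 0)
        + ((deriv (deriv (logDet n f)) (radius z) : ℝ) : ℂ) * (conj (z i) * z j)) := by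
  rw [ricciMatrix, Matrix.neg_apply,
    ← complexHessian_radial_of_mem (contDiffOn_logDet hn hf) hz i j]
  congr 1
  refine congrFun (congrFun (complexHessian_congr ?_) i) j
  filter_upwards [(isOpen_shell n a b).mem_nhds hz] with w hw
  exact log_det_radialMetric hn hf hw

/-- The derivative of `log det g = (n - 1) log f' + log y'`. In dimension one the
first term is zero, also where `f'` vanishes. -/
lemma deriv_logDet (hn : 1 ≤ n) (hf : IsRadialKahlerPotential n f a b) {r : ℝ}
    (hr : r ∈ interval a b) :
    deriv (logDet n f) r = ((n : ℝ) - 1) * deriv (deriv f) r / deriv f r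
      + deriv (deriv (yFun f)) r / deriv (yFun f) r := by
  have hy := deriv_yFun_pos hn hf hr
  have hp := pow_deriv_ne_zero hn hf hr
  have h1 := (((hf.smooth.deriv_interval.hasDerivAt_interval hr).pow (n - 1)).mul
    ((contDiffOn_yFun hf.smooth).deriv_interval.hasDerivAt_interval hr)).log
      (mul_ne_zero hp hy.ne')
  have h2 := h1.deriv
  refine Eq.trans (b := _) h2 ?_
  obtain ⟨m, rfl⟩ : ∃ m, n = m + 1 := ⟨n - 1, by omega⟩
  rcases m with _ | m
  · simp
  · have hf1 : deriv f r ≠ 0 := by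
      rcases eq_one_or_deriv_ne_zero hn hf hr with h | h
      · omega
      · exact h
    have := hy.ne'
    simp only [Pi.mul_apply, Pi.pow_apply]
    push_cast
    simp only [pow_succ]
    field_simp
    ring

end Profile

/-! ### Circle averages of holomorphic functions on an annulus -/

/-- The average over `|ζ| = s` of a function holomorphic on an annulus does not depend on `s`. -/
lemma circleAverage_eq_of_holomorphic {h : ℂ → ℂ} {s t : ℝ} (hs : 0 < s) (hst : s ≤ t)
    (hd : ∀ ζ : ℂ, s ≤ ‖ζ‖ → ‖ζ‖ ≤ t → DifferentiableAt ℂ h ζ) :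
    Real.circleAverage h 0 t = Real.circleAverage h 0 s := by
  rw [Real.circleAverage_eq_circleIntegral (hs.trans_le hst).ne',
    Real.circleAverage_eq_circleIntegral hs.ne',
    Complex.circleIntegral_sub_center_inv_smul_eq_of_differentiable_on_annulus_off_countable hs hst
      Set.countable_empty]
  · intro ζ hζ
    simp only [Set.mem_sdiff, Metric.mem_closedBall, Metric.mem_ball, dist_zero_right, not_lt] at hζ
    exact (hd ζ hζ.2 hζ.1).continuousAt.continuousWithinAt
  · intro ζ hζ
    simp only [Set.mem_sdiff, Metric.mem_closedBall, Metric.mem_ball, dist_zero_right,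
      not_le] at hζ
    exact hd ζ hζ.1.2.le hζ.1.1.le

/-- Write `p = ζ h`, so that `p' = h + ζ h'`; the average of `ζ h'` is `(2πi)⁻¹ ∮ h' dζ = 0`. -/
lemma circleAverage_deriv_eq {p : ℂ → ℂ} {s : ℝ} {U : Set ℂ} (hs : 0 < s) (hU : IsOpen U)
    (hsU : Metric.sphere 0 s ⊆ U) (hp : DifferentiableOn ℂ p U) :
    Real.circleAverage (deriv p) 0 s = Real.circleAverage (fun ζ => ζ⁻¹ * p ζ) 0 s := by
  have hne : ∀ ζ ∈ Metric.sphere (0 : ℂ) s, ζ ≠ 0 := by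
    rintro ζ hζ rfl
    simp at hζ
    exact hs.ne hζ
  have habs : |s| = s := abs_of_pos hs
  have hd : ∀ ζ ∈ Metric.sphere (0 : ℂ) s, HasDerivAt p (deriv p ζ) ζ := fun ζ hζ =>
    (hp.differentiableAt (hU.mem_nhds (hsU hζ))).hasDerivAt
  have hi1 : CircleIntegrable (deriv p) 0 s :=
    (((hp.deriv hU).continuousOn).mono hsU).circleIntegrable hs.le
  have hi2 : CircleIntegrable (fun ζ => ζ⁻¹ * p ζ) 0 s := by
    refine ContinuousOn.circleIntegrable hs.le ?_
    exact (continuousOn_id.inv₀ hne).mul (hp.continuousOn.mono hsU)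
  rw [← sub_eq_zero, ← Real.circleAverage_sub hi1 hi2,
    Real.circleAverage_eq_circleIntegral hs.ne']
  have h0 : (∮ ζ in C(0, s), (ζ - 0)⁻¹ • (deriv p - fun ζ => ζ⁻¹ * p ζ) ζ) = 0 := by
    refine circleIntegral.integral_eq_zero_of_hasDerivWithinAt (f := fun ζ => ζ⁻¹ * p ζ) hs.le
      fun ζ hζ => ?_
    refine (((hasDerivAt_inv (hne ζ hζ)).mul (hd ζ hζ)).congr_deriv ?_).hasDerivWithinAt
    have := hne ζ hζ
    simp only [sub_zero, Pi.sub_apply, smul_eq_mul]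
    field_simp
    ring
  rw [h0, smul_zero]

lemma circleAverage_re {h : ℂ → ℂ} {s : ℝ} (hh : CircleIntegrable h 0 s) :
    Real.circleAverage (fun ζ => (h ζ).re) 0 s = (Real.circleAverage h 0 s).re :=
  Complex.reCLM.circleAverage_comp_comm hh

lemma circleAverage_circleAverage_comm {k : ℂ → ℂ → ℝ} {s t : ℝ} (hs : 0 ≤ s) (ht : 0 ≤ t)
    (hk : ContinuousOn (Function.uncurry k) (Metric.sphere 0 s ×ˢ Metric.sphere 0 t)) :
    Real.circleAverage (fun ζ => Real.circleAverage (k ζ) 0 t) 0 s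
      = Real.circleAverage (fun η => Real.circleAverage (fun ζ => k ζ η) 0 s) 0 t := by
  have hc : Continuous (Function.uncurry fun θ τ : ℝ => k (circleMap 0 s θ) (circleMap 0 t τ)) :=
    hk.comp_continuous (f := fun x : ℝ × ℝ => (circleMap 0 s x.1, circleMap 0 t x.2))
      (by fun_prop)
      fun x => ⟨circleMap_mem_sphere 0 hs _, circleMap_mem_sphere 0 ht _⟩
  simp only [Real.circleAverage, intervalIntegral.integral_smul]
  rw [MeasureTheory.intervalIntegral_intervalIntegral_swap]
  exact (hc.continuousOn.integrableOn_compact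
    (isCompact_uIcc.prod isCompact_uIcc)).mono_set
    (Set.prod_mono Set.uIoc_subset_uIcc Set.uIoc_subset_uIcc)

/-- For `G` holomorphic in each of its two variables, the average over `|ζ| = s` of `∂G/∂η(ζ, 0)`
does not depend on `s`: by Cauchy's formula it is an average over a small circle in `η` of
averages over `ζ`. -/
lemma circleAverage_deriv_snd_eq {G : ℂ → ℂ → ℂ} {s t ε : ℝ} (hs : 0 < s) (hst : s ≤ t)
    (hε : 0 < ε)
    (hc : ContinuousOn (Function.uncurry G) {x | s ≤ ‖x.1‖ ∧ ‖x.1‖ ≤ t ∧ ‖x.2‖ ≤ ε})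
    (h1 : ∀ ζ η : ℂ, s ≤ ‖ζ‖ → ‖ζ‖ ≤ t → ‖η‖ ≤ ε → DifferentiableAt ℂ (fun ξ => G ξ η) ζ)
    (h2 : ∀ ζ η : ℂ, s ≤ ‖ζ‖ → ‖ζ‖ ≤ t → ‖η‖ ≤ ε → DifferentiableAt ℂ (G ζ) η) :
    Real.circleAverage (fun ζ => (deriv (G ζ) 0).re) 0 t
      = Real.circleAverage (fun ζ => (deriv (G ζ) 0).re) 0 s := by
  have hne : ∀ η ∈ Metric.sphere (0 : ℂ) ε, η ≠ 0 := by
    rintro η hη rfl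
    simp at hη
    exact hε.ne hη
  have key : ∀ u, s ≤ u → u ≤ t →
      Real.circleAverage (fun ζ => (deriv (G ζ) 0).re) 0 u
        = Real.circleAverage
          (fun η => (Real.circleAverage (fun ζ => η⁻¹ * G ζ η) 0 u).re) 0 ε := by
    intro u hsu hut
    have hu : 0 < u := hs.trans_le hsu
    have hcont : ContinuousOn (Function.uncurry fun ζ η => η⁻¹ * G ζ η)
        (Metric.sphere 0 u ×ˢ Metric.sphere 0 ε) := by
      refine (continuousOn_snd.inv₀ fun x hx => hne _ hx.2).mul (hc.mono ?_)
      rintro ⟨ζ, η⟩ ⟨hζ, hη⟩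
      simp only [mem_sphere_zero_iff_norm] at hζ hη
      exact ⟨hsu.trans hζ.ge, hζ.le.trans hut, hη.le⟩
    have e1 : ∀ ζ ∈ Metric.sphere (0 : ℂ) |u|, (deriv (G ζ) 0).re
        = Real.circleAverage (fun η => (η⁻¹ * G ζ η).re) 0 ε := by
      intro ζ hζ
      rw [abs_of_pos hu] at hζ
      have hζ' : ‖ζ‖ = u := by simpa using hζ
      rw [circleAverage_re, Real.circleAverage_eq_circleIntegral hε.ne']
      · have hcauchy := DifferentiableOn.deriv_eq_smul_circleIntegral (f := G ζ) (c := 0) hε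
          fun η hη => (h2 ζ η (hsu.trans hζ'.ge) (hζ'.le.trans hut)
            (by simpa using hη)).differentiableWithinAt
        have e : (fun η : ℂ => (η - 0)⁻¹ • (η⁻¹ * G ζ η)) = fun η => (1 / (η - 0) ^ 2) • G ζ η := by
          funext η
          simp only [sub_zero, smul_eq_mul, one_div, pow_two, mul_inv]
          ring
        rw [e, hcauchy, smul_smul, inv_mul_cancel₀ Complex.two_pi_I_ne_zero, one_smul]
      · refine ContinuousOn.circleIntegrable hε.le ?_
        exact hcont.comp (f := fun η => (ζ, η)) (by fun_prop) fun η hη => ⟨hζ, hη⟩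
    rw [Real.circleAverage_congr_sphere e1, circleAverage_circleAverage_comm
      (k := fun ζ η => (η⁻¹ * G ζ η).re) hu.le hε.le
      (Complex.continuous_re.comp_continuousOn hcont)]
    refine Real.circleAverage_congr_sphere fun η hη => ?_
    rw [abs_of_pos hε] at hη
    exact circleAverage_re (ContinuousOn.circleIntegrable hu.le
      (hcont.comp (f := fun ζ => (ζ, η)) (by fun_prop) fun ζ hζ => ⟨hζ, hη⟩))
  rw [key t hst le_rfl, key s le_rfl hst]
  refine Real.circleAverage_congr_sphere fun η hη => ?_
  rw [abs_of_pos hε] at hη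
  have hη' : ‖η‖ = ε := by simpa using hη
  exact congrArg Complex.re (circleAverage_eq_of_holomorphic hs hst fun ζ hζ1 hζ2 =>
    (differentiableAt_const _).mul (h1 ζ η hζ1 hζ2 hη'.le))

/-! ### The soliton equation along a complex line -/

section Soliton

variable {n : ℕ} {f : ℝ → ℝ} {a : ℝ} {b : EReal}

lemma formOf_single_I (h : Cn n → Matrix (Fin n) (Fin n) ℂ) (z : Cn n) (m : Fin n) :
    formOf h z (Pi.single m 1) (Pi.single m Complex.I) = h z m m := by
  rw [formOf, Finset.sum_eq_single m, Finset.sum_eq_single m]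
  · simp only [Pi.single_eq_same, Complex.conj_I, map_one]
    linear_combination (-(h z m m)) * Complex.I_mul_I
  · intro j _ hj
    simp [hj]
  · simp
  · intro i _ hi
    refine Finset.sum_eq_zero fun j _ => ?_
    simp [hi]
  · simp

lemma formOf_neg_left (h : Cn n → Matrix (Fin n) (Fin n) ℂ) (z u v : Cn n) :
    formOf h z (-u) v = -formOf h z u v := by
  simp only [formOf, Pi.neg_apply, map_neg, ← mul_neg, ← Finset.sum_neg_distrib]
  refine congrArg _ (Finset.sum_congr rfl fun i _ => Finset.sum_congr rfl fun j _ => ?_)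
  ring

lemma formOf_neg_right (h : Cn n → Matrix (Fin n) (Fin n) ℂ) (z u v : Cn n) :
    formOf h z u (-v) = -formOf h z u v := by
  simp only [formOf, Pi.neg_apply, map_neg, ← mul_neg, ← Finset.sum_neg_distrib]
  refine congrArg _ (Finset.sum_congr rfl fun i _ => Finset.sum_congr rfl fun j _ => ?_)
  ring

lemma formOf_single_I_right {h : Cn n → Matrix (Fin n) (Fin n) ℂ} {z : Cn n} {m : Fin n}
    (hr : ∀ j, j ≠ m → h z j m = 0) (hc : ∀ j, j ≠ m → h z m j = 0) (v : Cn n) :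
    formOf h z v (Pi.single m Complex.I) = h z m m * ((v m).re : ℂ) := by
  rw [formOf, Finset.sum_eq_single m, Finset.sum_eq_single m]
  · simp only [Pi.single_eq_same, Complex.conj_I]
    apply Complex.ext <;> simp <;> ring
  · intro j _ hj
    simp [hc j hj]
  · simp
  · intro i _ hi
    refine Finset.sum_eq_zero fun j _ => ?_
    by_cases hj : j = m
    · subst hj
      simp [hr i hi]
    · simp [hi, hj]
  · simp

lemma formOf_single_one_left {h : Cn n → Matrix (Fin n) (Fin n) ℂ} {z : Cn n} {m : Fin n}
    (hr : ∀ j, j ≠ m → h z j m = 0) (hc : ∀ j, j ≠ m → h z m j = 0) (v : Cn n) :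
    formOf h z (Pi.single m 1) v = h z m m * ((v m).im : ℂ) := by
  rw [formOf, Finset.sum_eq_single m, Finset.sum_eq_single m]
  · simp only [Pi.single_eq_same, map_one]
    apply Complex.ext <;> simp <;> ring
  · intro j _ hj
    simp [hc j hj]
  · simp
  · intro i _ hi
    refine Finset.sum_eq_zero fun j _ => ?_
    by_cases hj : j = m
    · subst hj
      simp [hr i hi]
    · simp [hi, hj]
  · simp

/-- The component of `L_X ω` on `(e_m, i e_m)`, at a point where the metric has no mixed terms with
`e_m`. -/
lemma lieDerivative_formOf_single {h : Cn n → Matrix (Fin n) (Fin n) ℂ} {X : Cn n → Cn n}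
    {z : Cn n} {m : Fin n} (hX : DifferentiableAt ℂ X z)
    (hr : ∀ j, j ≠ m → h z j m = 0) (hc : ∀ j, j ≠ m → h z m j = 0) :
    lieDerivative X (formOf h) z (Pi.single m 1) (Pi.single m Complex.I)
      = fderiv ℝ (fun w => h w m m) z (X z)
        + 2 * h z m m * ((fderiv ℂ X z (Pi.single m 1) m).re : ℂ) := by
  have hI : (Pi.single m Complex.I : Cn n) = Complex.I • Pi.single m 1 := by
    ext j
    by_cases hj : j = m
    · subst hj; simp
    · simp [hj]
  have hfd : fderiv ℝ X z = (fderiv ℂ X z).restrictScalars ℝ := hX.fderiv_restrictScalars ℝ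
  have hb : ∀ u : Cn n, VectorField.lieBracket ℝ X (fun _ => u) z = -fderiv ℂ X z u := by
    intro u
    rw [VectorField.lieBracket, hfd]
    simp
  simp only [lieDerivative, formOf_single_I, hb, formOf_neg_left, formOf_neg_right]
  rw [formOf_single_I_right hr hc, formOf_single_one_left hr hc, hI, map_smul]
  simp
  ring

/-- The differential of `g_{m m̄} = f' + f'' |z_m|²`. -/
lemma fderiv_radialMetric_diag (hf : ContDiffOn ℝ ∞ f (interval a b)) {z : Cn n}
    (hz : z ∈ shell n a b) (m : Fin n) (u : Cn n) :
    fderiv ℝ (fun w => radialMetric n f w m m) z u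
      = (((deriv (deriv f) (radius z)
          + deriv (deriv (deriv f)) (radius z) * Complex.normSq (z m)) * radiusDeriv z u
        + deriv (deriv f) (radius z) * (2 * (z m).re * (u m).re + 2 * (z m).im * (u m).im) : ℝ)
          : ℂ) := by
  have hS := eventually_radius_mem hz
  have h1 := hasFDerivAt_comp_radius hS
    (hf.deriv_interval.hasDerivAt_interval hz).hasDerivWithinAt
  have h2 := hasFDerivAt_comp_radius hS
    (hf.deriv_interval.deriv_interval.hasDerivAt_interval hz).hasDerivWithinAt
  have hre : HasFDerivAt (fun w : Cn n => (w m).re) _ z :=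
    Complex.reCLM.hasFDerivAt.comp z (hasFDerivAt_coord m z)
  have him : HasFDerivAt (fun w : Cn n => (w m).im) _ z :=
    Complex.imCLM.hasFDerivAt.comp z (hasFDerivAt_coord m z)
  have h3 : HasFDerivAt (fun w : Cn n => Complex.normSq (w m)) _ z :=
    (hre.mul hre).add (him.mul him)
  have h4 : HasFDerivAt (fun w : Cn n => ((deriv f (radius w)
      + deriv (deriv f) (radius w) * Complex.normSq (w m) : ℝ) : ℂ)) _ z :=
    Complex.ofRealCLM.hasFDerivAt.comp z (h1.add (h2.mul h3))
  have h5 : (fun w => radialMetric n f w m m) =ᶠ[nhds z] fun w => ((deriv f (radius w)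
      + deriv (deriv f) (radius w) * Complex.normSq (w m) : ℝ) : ℂ) := by
    filter_upwards [(isOpen_shell n a b).mem_nhds hz] with w hw
    rw [radialMetric_apply hf hw, ← Complex.normSq_eq_conj_mul_self]
    push_cast
    simp
  rw [h5.fderiv_eq, h4.fderiv]
  simp
  ring

variable [NeZero n]

lemma axisPoint_of_ne {ζ : ℂ} {m : Fin n} (hm : m ≠ 0) : axisPoint n ζ m = 0 :=
  Pi.single_eq_of_ne hm _

lemma axisPoint_zero (ζ : ℂ) : axisPoint n ζ 0 = ζ := Pi.single_eq_same _ _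

lemma radialMetric_axisPoint_of_ne (hf : ContDiffOn ℝ ∞ f (interval a b)) {ζ : ℂ}
    (hζ : Complex.normSq ζ ∈ interval a b) {i j : Fin n} (hij : i ≠ j) :
    radialMetric n f (axisPoint n ζ) i j = 0 := by
  rw [radialMetric_apply hf (axisPoint_mem hζ)]
  by_cases hi : i = 0
  · have hj : j ≠ 0 := fun h => hij (hi.trans h.symm)
    simp [hij, axisPoint_of_ne hj]
  · simp [hij, axisPoint_of_ne hi]

lemma radiusDeriv_axisPoint (ζ : ℂ) (u : Cn n) :
    radiusDeriv (axisPoint n ζ) u = 2 * (u 0 * conj ζ).re := by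
  rw [radiusDeriv_apply, Finset.sum_eq_single 0]
  · simp only [axisPoint_zero, Complex.mul_re, Complex.conj_re, Complex.conj_im]
    ring
  · intro j _ hj
    simp [axisPoint_of_ne hj]
  · simp

variable {X : Cn n → Cn n} {lam : ℝ}

/-- The soliton equation at `z = (ζ, 0, …, 0)` in the radial direction. -/
lemma IsSoliton.radial_eq (hf : IsRadialKahlerPotential n f a b)
    (hX : IsSoliton (radialMetric n f) X lam (shell n a b)) {ζ : ℂ}
    (hζ : Complex.normSq ζ ∈ interval a b) :
    -(deriv (logDet n f) (Complex.normSq ζ)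
        + Complex.normSq ζ * deriv (deriv (logDet n f)) (Complex.normSq ζ))
      = lam * deriv (yFun f) (Complex.normSq ζ)
        + deriv (deriv (yFun f)) (Complex.normSq ζ)
          * (2 * (X (axisPoint n ζ) 0 * conj ζ).re)
        + 2 * deriv (yFun f) (Complex.normSq ζ)
          * (fderiv ℂ X (axisPoint n ζ) (Pi.single 0 1) 0).re := by
  have hz : axisPoint n ζ ∈ shell n a b := axisPoint_mem hζ
  have h := hX.2 _ hz (Pi.single 0 1) (Pi.single 0 Complex.I)
  rw [lieDerivative_formOf_single (hX.1.differentiableAt ((isOpen_shell n a b).mem_nhds hz))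
      (fun j hj => radialMetric_axisPoint_of_ne hf.smooth hζ hj)
      (fun j hj => radialMetric_axisPoint_of_ne hf.smooth hζ hj.symm),
    formOf_single_I, formOf_single_I, fderiv_radialMetric_diag hf.smooth hz,
    ricciMatrix_radial (NeZero.one_le) hf hz, radialMetric_apply hf.smooth hz,
    radiusDeriv_axisPoint, radius_axisPoint] at h
  simp only [axisPoint_zero, if_true, mul_one, ← Complex.normSq_eq_conj_mul_self] at h
  rw [deriv_yFun hf.smooth hζ, deriv_deriv_yFun hf.smooth hζ]
  have h' := congrArg Complex.re h
  simp at h' ⊢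
  linarith

/-- The soliton equation at `z = (ζ, 0, …, 0)` in a direction orthogonal to `z`. -/
lemma IsSoliton.transversal_eq (hf : IsRadialKahlerPotential n f a b)
    (hX : IsSoliton (radialMetric n f) X lam (shell n a b)) {ζ : ℂ}
    (hζ : Complex.normSq ζ ∈ interval a b) {m : Fin n} (hm : m ≠ 0) :
    -deriv (logDet n f) (Complex.normSq ζ)
      = lam * deriv f (Complex.normSq ζ)
        + deriv (deriv f) (Complex.normSq ζ) * (2 * (X (axisPoint n ζ) 0 * conj ζ).re)
        + 2 * deriv f (Complex.normSq ζ)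
          * (fderiv ℂ X (axisPoint n ζ) (Pi.single m 1) m).re := by
  have hz : axisPoint n ζ ∈ shell n a b := axisPoint_mem hζ
  have h := hX.2 _ hz (Pi.single m 1) (Pi.single m Complex.I)
  rw [lieDerivative_formOf_single (hX.1.differentiableAt ((isOpen_shell n a b).mem_nhds hz))
      (fun j hj => radialMetric_axisPoint_of_ne hf.smooth hζ hj)
      (fun j hj => radialMetric_axisPoint_of_ne hf.smooth hζ hj.symm),
    formOf_single_I, formOf_single_I, fderiv_radialMetric_diag hf.smooth hz,
    ricciMatrix_radial (NeZero.one_le) hf hz, radialMetric_apply hf.smooth hz,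
    radiusDeriv_axisPoint, radius_axisPoint] at h
  have h' := congrArg Complex.re h
  simp [axisPoint_of_ne hm] at h' ⊢
  linarith

end Soliton

lemma differentiableAt_of_mem {n : ℕ} {a : ℝ} {b : EReal} {X : Cn n → Cn n}
    (hX : DifferentiableOn ℂ X (shell n a b)) {z : Cn n} (hz : z ∈ shell n a b) :
    DifferentiableAt ℂ X z :=
  hX.differentiableAt ((isOpen_shell n a b).mem_nhds hz)

/-! ### The averaged soliton equation -/

section SolitonAverage

variable {n : ℕ} {f : ℝ → ℝ} {a : ℝ} {b : EReal} [NeZero n] {X : Cn n → Cn n} {lam : ℝ}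

lemma axisPoint_eq_smul (ζ : ℂ) : axisPoint n ζ = ζ • (Pi.single 0 1 : Cn n) := by
  ext j
  by_cases hj : j = 0
  · subst hj; simp [axisPoint]
  · simp [axisPoint, hj]

lemma hasDerivAt_axis {X : Cn n → Cn n} {ζ : ℂ} (hX : DifferentiableAt ℂ X (axisPoint n ζ)) :
    HasDerivAt (fun ξ => X (axisPoint n ξ) 0)
      (fderiv ℂ X (axisPoint n ζ) (Pi.single 0 1) 0) ζ := by
  have h1 : HasDerivAt (fun ξ : ℂ => axisPoint n ξ) (Pi.single 0 1) ζ := by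
    simp only [axisPoint_eq_smul]
    simpa using (hasDerivAt_id ζ).smul_const (Pi.single 0 1 : Cn n)
  exact hasDerivAt_pi.1 (hX.hasFDerivAt.comp_hasDerivAt ζ h1) 0

/-- The point with coordinates `ζ` at `0` and `η` at `m`. -/
noncomputable def planePoint (m : Fin n) (ζ η : ℂ) : Cn n :=
  ζ • (Pi.single 0 1 : Cn n) + η • (Pi.single m 1 : Cn n)

lemma planePoint_zero_right (m : Fin n) (ζ : ℂ) : planePoint m ζ 0 = axisPoint n ζ := by
  simp [planePoint, axisPoint_eq_smul]

lemma radius_planePoint {m : Fin n} (hm : m ≠ 0) (ζ η : ℂ) :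
    radius (planePoint m ζ η) = Complex.normSq ζ + Complex.normSq η := by
  rw [radius, Finset.sum_eq_add 0 m hm.symm]
  · simp [planePoint, hm, hm.symm]
  · intro j _ hj
    simp [planePoint, hj.1, hj.2]
  · simp
  · simp

lemma hasDerivAt_planePoint_left (m : Fin n) (ζ η : ℂ) :
    HasDerivAt (fun ξ => planePoint m ξ η) (Pi.single 0 1) ζ := by
  simpa [planePoint] using
    ((hasDerivAt_id ζ).smul_const (Pi.single 0 1 : Cn n)).add_const (η • (Pi.single m 1 : Cn n))

lemma hasDerivAt_planePoint_right (m : Fin n) (ζ η : ℂ) :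
    HasDerivAt (planePoint m ζ) (Pi.single m 1) η := by
  have h : HasDerivAt (planePoint m ζ) _ η :=
    ((hasDerivAt_id η).smul_const (Pi.single m 1 : Cn n)).const_add (ζ • (Pi.single 0 1 : Cn n))
  simpa using h

lemma mem_interval_of_norm {ζ : ℂ} {r₁ r₂ : ℝ} (hr : 0 ≤ r₂) (h₁ : r₁ ∈ interval a b)
    (h₂ : r₂ ∈ interval a b)
    (h₁' : Real.sqrt r₁ ≤ ‖ζ‖) (h₂' : ‖ζ‖ ≤ Real.sqrt r₂) : Complex.normSq ζ ∈ interval a b := by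
  have e1 := (Real.sqrt_le_left (norm_nonneg _)).1 h₁'
  have e2 := pow_le_pow_left₀ (norm_nonneg _) h₂' 2
  rw [Real.sq_sqrt hr] at e2
  rw [Complex.normSq_eq_norm_sq]
  exact (ordConnected_interval a b).out h₁ h₂ ⟨e1, e2⟩

/-- The average of `X_0(ζ e_0)/ζ` over the circle `|ζ|² = r`. -/
noncomputable def axisAverage (X : Cn n → Cn n) (r : ℝ) : ℂ :=
  Real.circleAverage (fun ζ => ζ⁻¹ * X (axisPoint n ζ) 0) 0 (Real.sqrt r)

/-- The average over the circle `|ζ|² = r` of the real part of `∂X_m/∂z_m` at `(ζ, 0, …, 0)`. -/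
noncomputable def transversalAverage (X : Cn n → Cn n) (m : Fin n) (r : ℝ) : ℝ :=
  Real.circleAverage (fun ζ => (fderiv ℂ X (axisPoint n ζ) (Pi.single m 1) m).re) 0 (Real.sqrt r)

lemma axisAverage_eq (ha : 0 ≤ a) (hX : DifferentiableOn ℂ X (shell n a b)) {r s : ℝ}
    (hr : r ∈ interval a b) (hs : s ∈ interval a b) : axisAverage X r = axisAverage X s := by
  wlog h : s ≤ r generalizing r s
  · exact (this hs hr (le_of_not_ge h)).symm
  refine circleAverage_eq_of_holomorphic (Real.sqrt_pos.2 (ha.trans_lt hs.1)) (Real.sqrt_le_sqrt h)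
    fun ζ h1 h2 => ?_
  have hζ : ζ ≠ 0 := norm_pos_iff.1 ((Real.sqrt_pos.2 (ha.trans_lt hs.1)).trans_le h1)
  exact (differentiableAt_inv hζ).mul (hasDerivAt_axis (differentiableAt_of_mem hX
    (axisPoint_mem (mem_interval_of_norm (ha.trans hr.1.le) hs hr h1 h2)))).differentiableAt

lemma transversalAverage_eq (ha : 0 ≤ a) (hX : DifferentiableOn ℂ X (shell n a b)) {m : Fin n}
    (hm : m ≠ 0) {r s : ℝ} (hr : r ∈ interval a b) (hs : s ∈ interval a b) :
    transversalAverage X m r = transversalAverage X m s := by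
  wlog h : s ≤ r generalizing r s
  · exact (this hs hr (le_of_not_ge h)).symm
  have hs0 : 0 < s := ha.trans_lt hs.1
  have hr0 : 0 < r := ha.trans_lt hr.1
  obtain ⟨t, ht, hrt⟩ := exists_lt_mem_interval hr
  -- a circle in the `z_m` direction small enough for `ζ e_0 + η e_m` to stay in the shell
  set ε := Real.sqrt (t - r) with hε
  have hmem : ∀ ζ η : ℂ, Real.sqrt s ≤ ‖ζ‖ → ‖ζ‖ ≤ Real.sqrt r → ‖η‖ ≤ ε →
      planePoint m ζ η ∈ shell n a b := by
    intro ζ η h1 h2 h3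
    have e1 := pow_le_pow_left₀ (Real.sqrt_nonneg _) h1 2
    have e2 := pow_le_pow_left₀ (norm_nonneg _) h2 2
    have e3 := pow_le_pow_left₀ (norm_nonneg _) h3 2
    rw [Real.sq_sqrt hs0.le] at e1
    rw [Real.sq_sqrt hr0.le] at e2
    rw [hε, Real.sq_sqrt (by linarith)] at e3
    rw [shell, Set.mem_ofPred_eq, radius_planePoint hm, Complex.normSq_eq_norm_sq,
      Complex.normSq_eq_norm_sq]
    exact (ordConnected_interval a b).out hs ht ⟨by nlinarith [sq_nonneg ‖η‖], by linarith⟩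
  have hl : ∀ ζ η : ℂ, planePoint m ζ η ∈ shell n a b →
      HasDerivAt (fun ξ => X (planePoint m ξ η) m)
        (fderiv ℂ X (planePoint m ζ η) (Pi.single 0 1) m) ζ := fun ζ η hz =>
    hasDerivAt_pi.1 ((differentiableAt_of_mem hX hz).hasFDerivAt.comp_hasDerivAt ζ
      (hasDerivAt_planePoint_left m ζ η)) m
  have hr' : ∀ ζ η : ℂ, planePoint m ζ η ∈ shell n a b →
      HasDerivAt (fun ξ => X (planePoint m ζ ξ) m)
        (fderiv ℂ X (planePoint m ζ η) (Pi.single m 1) m) η := fun ζ η hz =>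
    hasDerivAt_pi.1 ((differentiableAt_of_mem hX hz).hasFDerivAt.comp_hasDerivAt η
      (hasDerivAt_planePoint_right m ζ η)) m
  have hε0 : 0 < ε := Real.sqrt_pos.2 (by linarith)
  have key := circleAverage_deriv_snd_eq (G := fun ζ η => X (planePoint m ζ η) m)
    (Real.sqrt_pos.2 hs0) (Real.sqrt_le_sqrt h) hε0 ?_
    (fun ζ η h1 h2 h3 => (hl ζ η (hmem ζ η h1 h2 h3)).differentiableAt)
    (fun ζ η h1 h2 h3 => (hr' ζ η (hmem ζ η h1 h2 h3)).differentiableAt)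
  · have hcong : ∀ u, s ≤ u → u ≤ r →
        transversalAverage X m u = Real.circleAverage
          (fun ζ => (deriv (fun η => X (planePoint m ζ η) m) 0).re) 0 (Real.sqrt u) := by
      intro u hsu hur
      refine Real.circleAverage_congr_sphere fun ζ hζ => ?_
      rw [abs_of_nonneg (Real.sqrt_nonneg _), mem_sphere_zero_iff_norm] at hζ
      have hd := hr' ζ 0 (hmem ζ 0 (hζ ▸ Real.sqrt_le_sqrt hsu) (hζ ▸ Real.sqrt_le_sqrt hur)
        (by simpa using hε0.le))
      simp only [hd.deriv, planePoint_zero_right]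
    rw [hcong r h le_rfl, hcong s le_rfl h, key]
  · have hcX : ContinuousOn (fun z => X z m) (shell n a b) := fun z hz =>
      ((continuous_apply m).continuousAt.comp
        (differentiableAt_of_mem hX hz).continuousAt).continuousWithinAt
    refine hcX.comp (f := fun x : ℂ × ℂ => planePoint m x.1 x.2) ?_
      fun x hx => hmem _ _ hx.1 hx.2.1 hx.2.2
    unfold planePoint
    fun_prop

/-- The Kähler-Ricci soliton equation, averaged over the circles `|ζ|² = r` in the complex line of
`e_0`. The averages `c` of `X_0/ζ` and `e` of `∂X_m/∂z_m` are constants, since these functions are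
holomorphic in `ζ`. -/
lemma IsSoliton.averaged_eq (hf : IsRadialKahlerPotential n f a b)
    (hX : IsSoliton (radialMetric n f) X lam (shell n a b)) :
    ∃ c : ℝ,
      (∀ r ∈ interval a b, -(deriv (logDet n f) r + r * deriv (deriv (logDet n f)) r)
        = lam * deriv (yFun f) r + 2 * c * r * deriv (deriv (yFun f)) r
          + 2 * c * deriv (yFun f) r) ∧
      ∀ m : Fin n, m ≠ 0 → ∃ e : ℝ, ∀ r ∈ interval a b, -deriv (logDet n f) r
        = lam * deriv f r + 2 * c * r * deriv (deriv f) r + 2 * e * deriv f r := by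
  obtain ⟨r₀, hr₀⟩ := nonempty_interval hf.lt
  have hU : IsOpen {ζ : ℂ | Complex.normSq ζ ∈ interval a b} :=
    (isOpen_interval a b).preimage Complex.continuous_normSq
  have hdiff : DifferentiableOn ℂ (fun ζ => X (axisPoint n ζ) 0)
      {ζ : ℂ | Complex.normSq ζ ∈ interval a b} := fun ζ hζ =>
    (hasDerivAt_axis (differentiableAt_of_mem hX.1
      (axisPoint_mem hζ))).differentiableAt.differentiableWithinAt
  have hsphere : ∀ r ∈ interval a b, ∀ ζ ∈ Metric.sphere (0 : ℂ) (Real.sqrt r),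
      Complex.normSq ζ = r := by
    intro r hr ζ hζ
    rw [mem_sphere_zero_iff_norm] at hζ
    rw [Complex.normSq_eq_norm_sq, hζ, Real.sq_sqrt (hf.pos hr).le]
  have hsub : ∀ r ∈ interval a b, Metric.sphere (0 : ℂ) (Real.sqrt r)
      ⊆ {ζ : ℂ | Complex.normSq ζ ∈ interval a b} := fun r hr ζ hζ => by
    rw [Set.mem_ofPred_eq, hsphere r hr ζ hζ]
    exact hr
  have hne : ∀ r ∈ interval a b, ∀ ζ ∈ Metric.sphere (0 : ℂ) (Real.sqrt r), ζ ≠ 0 := by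
    rintro r hr ζ hζ rfl
    have := hsphere r hr 0 hζ
    simp only [map_zero] at this
    exact (hf.pos hr).ne this
  have hint : ∀ r ∈ interval a b,
      CircleIntegrable (fun ζ => ζ⁻¹ * X (axisPoint n ζ) 0) 0 (Real.sqrt r) := fun r hr =>
    ((continuousOn_id.inv₀ (hne r hr)).mul
      (hdiff.continuousOn.mono (hsub r hr))).circleIntegrable (Real.sqrt_nonneg _)
  have hre : ∀ {h : ℂ → ℂ} {s : ℝ}, CircleIntegrable h 0 s →
      CircleIntegrable (fun ζ => (h ζ).re) 0 s := fun hh => ⟨hh.1.re, hh.2.re⟩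
  have hav : ∀ r ∈ interval a b,
      Real.circleAverage (fun ζ => (ζ⁻¹ * X (axisPoint n ζ) 0).re) 0 (Real.sqrt r)
        = (axisAverage X r₀).re := fun r hr => by
    rw [circleAverage_re (hint r hr), ← axisAverage_eq hf.nonneg hX.1 hr hr₀, axisAverage]
  have hconj : ∀ r ∈ interval a b, ∀ ζ ∈ Metric.sphere (0 : ℂ) (Real.sqrt r),
      (X (axisPoint n ζ) 0 * conj ζ).re = r * (ζ⁻¹ * X (axisPoint n ζ) 0).re := by
    intro r hr ζ hζ
    have e : X (axisPoint n ζ) 0 * conj ζ = (r : ℂ) * (ζ⁻¹ * X (axisPoint n ζ) 0) := by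
      have := hne r hr ζ hζ
      rw [← hsphere r hr ζ hζ, Complex.normSq_eq_conj_mul_self]
      field_simp
    rw [e, Complex.re_ofReal_mul]
  refine ⟨(axisAverage X r₀).re, fun r hr => ?_, fun m hm => ⟨transversalAverage X m r₀,
    fun r hr => ?_⟩⟩
  · have hp' : CircleIntegrable (deriv fun ζ => X (axisPoint n ζ) 0) 0 (Real.sqrt r) :=
      ((hdiff.deriv hU).continuousOn.mono (hsub r hr)).circleIntegrable (Real.sqrt_nonneg _)
    have e1 : ∀ ζ ∈ Metric.sphere (0 : ℂ) |Real.sqrt r|,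
        -(deriv (logDet n f) r + r * deriv (deriv (logDet n f)) r)
          = lam * deriv (yFun f) r
            + ((2 * r * deriv (deriv (yFun f)) r) • (ζ⁻¹ * X (axisPoint n ζ) 0).re
              + (2 * deriv (yFun f) r) • (deriv (fun ζ => X (axisPoint n ζ) 0) ζ).re) := by
      intro ζ hζ
      rw [abs_of_nonneg (Real.sqrt_nonneg _)] at hζ
      have hN := hsphere r hr ζ hζ
      have h := hX.radial_eq hf (ζ := ζ) (hN ▸ hr)
      rw [hN, hconj r hr ζ hζ, ← (hasDerivAt_axis (differentiableAt_of_mem hX.1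
        (axisPoint_mem (hN ▸ hr)))).deriv] at h
      rw [h, smul_eq_mul, smul_eq_mul]
      ring
    have e2 := Real.circleAverage_congr_sphere (E := ℝ) (f₁ := fun _ => _) e1
    rw [Real.circleAverage_const, Real.circleAverage_fun_add, Real.circleAverage_const,
      Real.circleAverage_fun_add, Real.circleAverage_fun_smul, Real.circleAverage_fun_smul,
      hav r hr, circleAverage_re hp', circleAverage_deriv_eq (Real.sqrt_pos.2 (hf.pos hr)) hU
        (hsub r hr) hdiff, ← circleAverage_re (hint r hr), hav r hr] at e2
    · rw [e2, smul_eq_mul, smul_eq_mul]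
      ring
    · exact (hre (hint r hr)).const_smul
    · exact (hre hp').const_smul
    · exact circleIntegrable_const _ _ _
    · exact ((hre (hint r hr)).const_smul).add ((hre hp').const_smul)
  · have hn : 2 ≤ n := by
      have := m.2
      have : (m : ℕ) ≠ 0 := fun h => hm (Fin.ext h)
      omega
    have hf1 := deriv_pos hn hf hr
    -- the transversal equation expresses the real part of `∂X_m/∂z_m` by that of `X_0/ζ`
    have e1 : ∀ ζ ∈ Metric.sphere (0 : ℂ) |Real.sqrt r|,
        (fderiv ℂ X (axisPoint n ζ) (Pi.single m 1) m).re
          = (-deriv (logDet n f) r - lam * deriv f r) / (2 * deriv f r)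
            + (-(r * deriv (deriv f) r) / deriv f r) • (ζ⁻¹ * X (axisPoint n ζ) 0).re := by
      intro ζ hζ
      rw [abs_of_nonneg (Real.sqrt_nonneg _)] at hζ
      have hN := hsphere r hr ζ hζ
      have h := hX.transversal_eq hf (ζ := ζ) (hN ▸ hr) hm
      rw [hN, hconj r hr ζ hζ] at h
      rw [h, smul_eq_mul]
      field_simp
      ring
    have e2 := Real.circleAverage_congr_sphere e1
    rw [Real.circleAverage_fun_add, Real.circleAverage_const, Real.circleAverage_fun_smul,
      hav r hr] at e2
    · have e3 := transversalAverage_eq hf.nonneg hX.1 hm hr₀ hr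
      rw [e3, transversalAverage, e2, smul_eq_mul]
      field_simp
      ring
    · exact circleIntegrable_const _ _ _
    · exact (hre (hint r hr)).const_smul

end SolitonAverage

/-! ### The ordinary differential equation of a soliton -/

section ODE

variable {n : ℕ} {f : ℝ → ℝ} {a : ℝ} {b : EReal}

/-- `r d/dr log det g = (n - 1) (ψ/y - 1) + dψ/dy - 1`. In dimension one the first summand is zero,
also where `y` vanishes. -/
lemma mul_deriv_logDet (hn : 1 ≤ n) (hf : IsRadialKahlerPotential n f a b) {r : ℝ}
    (hr : r ∈ interval a b) :
    r * deriv (logDet n f) r = ((n : ℝ) - 1) * (psi f r / yFun f r - 1)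
      + (deriv (psi f) r / deriv (yFun f) r - 1) := by
  have hr0 := (hf.pos hr).ne'
  have hy := (deriv_yFun_pos hn hf hr).ne'
  rw [deriv_logDet hn hf hr, deriv_psi hf.smooth hr, mul_add]
  congr 1
  · rcases eq_one_or_deriv_ne_zero hn hf hr with h | h
    · simp [h]
    · rw [psi, yFun, deriv_yFun hf.smooth hr]
      field_simp
      ring
  · field_simp
    ring

/-- The averaged soliton equation integrates to `r d/dr log det g + λ y + 2 c ψ = k`. In dimension
at least two the transversal equation gives `k = 2 (c - e) y`, which forces `k = 0`, since `y` is
not constant. -/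
lemma IsSoliton.exists_integrated (hn : 1 ≤ n) {X : Cn n → Cn n} {lam : ℝ}
    (hf : IsRadialKahlerPotential n f a b)
    (hX : IsSoliton (radialMetric n f) X lam (shell n a b)) :
    ∃ c k : ℝ, (2 ≤ n → k = 0) ∧ ∀ r ∈ interval a b,
      r * deriv (logDet n f) r + lam * yFun f r + 2 * c * psi f r = k := by
  have : NeZero n := ⟨by omega⟩
  obtain ⟨c, h1, h2⟩ := hX.averaged_eq hf
  have hL := contDiffOn_logDet hn hf
  have hy := contDiffOn_yFun hf.smooth
  have hd : ∀ r ∈ interval a b, HasDerivAt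
      (fun r => r * deriv (logDet n f) r + lam * yFun f r + 2 * c * psi f r) 0 r := by
    intro r hr
    have e := (((hasDerivAt_id r).mul (hL.deriv_interval.hasDerivAt_interval hr)).add
      ((hy.hasDerivAt_interval hr).const_mul lam)).add
      (((contDiffOn_psi hf.smooth).hasDerivAt_interval hr).const_mul (2 * c))
    refine e.congr_deriv ?_
    rw [deriv_psi hf.smooth hr]
    simp only [id, one_mul]
    linarith [h1 r hr]
  obtain ⟨k, hk⟩ := (isOpen_interval a b).exists_is_const_of_deriv_eq_zero
    (isPreconnected_interval a b)
    (fun r hr => (hd r hr).differentiableAt.differentiableWithinAt) (fun r hr => (hd r hr).deriv)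
  refine ⟨c, k, fun hn2 => ?_, hk⟩
  obtain ⟨e, he⟩ := h2 ⟨1, by omega⟩ (by simp [Fin.ext_iff])
  have h3 : ∀ r ∈ interval a b, k = 2 * (c - e) * yFun f r := by
    intro r hr
    rw [← hk r hr, psi, deriv_yFun hf.smooth hr, yFun]
    linear_combination (-r) * he r hr
  obtain ⟨r, hr, s, hs, hrs⟩ := not_const_yFun hn hf
  have h4 : (2 * (c - e)) * (yFun f s - yFun f r) = 0 := by
    linarith [h3 r hr, h3 s hs]
  rcases mul_eq_zero.1 h4 with h | h
  · rw [h3 r hr, h, zero_mul]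
  · linarith

lemma IsSoliton.exists_ode_one {f : ℝ → ℝ} {X : Cn 1 → Cn 1} {lam : ℝ}
    (hf : IsRadialKahlerPotential 1 f a b)
    (hX : IsSoliton (radialMetric 1 f) X lam (shell 1 a b)) :
    ∃ μ k : ℝ, ∀ y ∈ yRange f a b,
      HasDerivAt (psiOfY f a b) (μ * psiOfY f a b y + k + 1 - lam * y) y := by
  obtain ⟨c, k, -, h⟩ := hX.exists_integrated le_rfl hf
  refine ⟨-2 * c, k, ?_⟩
  rintro _ ⟨r, hr, rfl⟩
  have hy := (deriv_yFun_pos le_rfl hf hr).ne'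
  rw [hasDerivAt_psiOfY_iff le_rfl hf hr, psiOfY_yFun le_rfl hf hr, ← h r hr,
    mul_deriv_logDet le_rfl hf hr]
  push_cast
  field_simp
  ring

lemma IsSoliton.exists_ode (hn : 2 ≤ n) {X : Cn n → Cn n} {lam : ℝ}
    (hf : IsRadialKahlerPotential n f a b)
    (hX : IsSoliton (radialMetric n f) X lam (shell n a b)) :
    ∃ μ : ℝ, ∀ y ∈ yRange f a b,
      HasDerivAt (psiOfY f a b) ((μ - ((n : ℝ) - 1) / y) * psiOfY f a b y + n - lam * y) y := by
  have hn1 : 1 ≤ n := by omega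
  obtain ⟨c, k, hk, h⟩ := hX.exists_integrated hn1 hf
  refine ⟨-2 * c, ?_⟩
  rintro _ ⟨r, hr, rfl⟩
  have hy := (deriv_yFun_pos hn1 hf hr).ne'
  have hy0 := (yFun_pos hn hf hr).ne'
  have h1 := h r hr
  rw [hasDerivAt_psiOfY_iff hn1 hf hr, psiOfY_yFun hn1 hf hr]
  rw [mul_deriv_logDet hn1 hf hr, hk hn] at h1
  field_simp at h1 ⊢
  linear_combination h1

/-- A linear equation `u' = μ u + q` determines `u` up to a multiple of the exponential. -/
lemma exists_eq_add_exp {s : Set ℝ} (hs : IsOpen s) (hs' : IsPreconnected s) {μ : ℝ}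
    {u v q : ℝ → ℝ} (hu : ∀ y ∈ s, HasDerivAt u (μ * u y + q y) y)
    (hv : ∀ y ∈ s, HasDerivAt v (μ * v y + q y) y) :
    ∃ ν : ℝ, ∀ y ∈ s, u y = ν * Real.exp (μ * y) + v y := by
  have hd : ∀ y ∈ s, HasDerivAt (fun y => (u y - v y) * Real.exp (-(μ * y))) 0 y := by
    intro y hy
    have h1 := ((hu y hy).sub (hv y hy)).mul
      (((hasDerivAt_id y).const_mul μ).neg.exp)
    refine h1.congr_deriv ?_
    simp
    ring
  obtain ⟨ν, hν⟩ := hs.exists_is_const_of_deriv_eq_zero hs'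
    (fun r hr => (hd r hr).differentiableAt.differentiableWithinAt) (fun r hr => (hd r hr).deriv)
  refine ⟨ν, fun y hy => ?_⟩
  rw [← hν y hy, mul_assoc, ← Real.exp_add]
  simp

/-- The constant of integration in dimension one. -/
lemma exists_solution_one {f : ℝ → ℝ} {μ k lam : ℝ} (hf : IsRadialKahlerPotential 1 f a b)
    (hμ : μ ≠ 0) (h : ∀ y ∈ yRange f a b,
      HasDerivAt (psiOfY f a b) (μ * psiOfY f a b y + k + 1 - lam * y) y) :
    ∃ ν : ℝ, ∀ y ∈ yRange f a b, psiOfY f a b y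
      = ν * Real.exp (μ * y) + lam / μ * y + (lam / μ ^ 2 - (k + 1) / μ) := by
  obtain ⟨ν, hν⟩ := exists_eq_add_exp (u := psiOfY f a b) (q := fun y => k + 1 - lam * y)
    (v := fun y => lam / μ * y + (lam / μ ^ 2 - (k + 1) / μ)) (isOpen_yRange le_rfl hf)
    (ordConnected_yRange hf).isPreconnected (fun y hy => (h y hy).congr_deriv (by ring))
    (fun y hy => (((hasDerivAt_id y).const_mul (lam / μ)).add_const _).congr_deriv (by
      field_simp
      ring))
  exact ⟨ν, fun y hy => by rw [hν y hy]; ring⟩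

/-- The polynomial solution of `Q' = μ Q + (n - λ y) yⁿ⁻¹`. -/
noncomputable def polySolution (n : ℕ) (μ lam y : ℝ) : ℝ :=
  lam / μ * y ^ n + (lam - μ) / μ ^ (n + 1) *
    ∑ j ∈ Finset.range n, (n.factorial : ℝ) / (j.factorial : ℝ) * μ ^ j * y ^ j

/-- The sum telescopes: differentiation shifts the partial sum of the exponential series. -/
lemma hasDerivAt_expSum (n : ℕ) (μ y : ℝ) :
    HasDerivAt (fun y : ℝ => ∑ j ∈ Finset.range (n + 1), (1 / (j.factorial : ℝ)) * μ ^ j * y ^ j)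
      (μ * ∑ j ∈ Finset.range (n + 1), (1 / (j.factorial : ℝ)) * μ ^ j * y ^ j
        - μ ^ (n + 1) / n.factorial * y ^ n) y := by
  induction n with
  | zero => simpa using hasDerivAt_const y (1 : ℝ)
  | succ n ih =>
    have h1 : HasDerivAt
        (fun y : ℝ => (1 / ((n + 1).factorial : ℝ)) * μ ^ (n + 1) * y ^ (n + 1)) _ y :=
      (hasDerivAt_pow (n + 1) y).const_mul ((1 / ((n + 1).factorial : ℝ)) * μ ^ (n + 1))
    have h2 := ih.add h1
    have e : (fun y : ℝ => ∑ j ∈ Finset.range (n + 1 + 1),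
        (1 / (j.factorial : ℝ)) * μ ^ j * y ^ j)
        = (fun y : ℝ => ∑ j ∈ Finset.range (n + 1), (1 / (j.factorial : ℝ)) * μ ^ j * y ^ j)
          + fun y : ℝ => (1 / ((n + 1).factorial : ℝ)) * μ ^ (n + 1) * y ^ (n + 1) := by
      funext x
      rw [Finset.sum_range_succ]
      rfl
    rw [e]
    refine h2.congr_deriv ?_
    rw [Finset.sum_range_succ _ (n + 1), Nat.factorial_succ]
    have : (n.factorial : ℝ) ≠ 0 := by positivity
    have : (n : ℝ) + 1 ≠ 0 := by positivity
    push_cast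
    field_simp
    ring

lemma hasDerivAt_polySolution (hn : 1 ≤ n) {μ lam : ℝ} (hμ : μ ≠ 0) (y : ℝ) :
    HasDerivAt (polySolution n μ lam)
      (μ * polySolution n μ lam y + (n - lam * y) * y ^ (n - 1)) y := by
  obtain ⟨m, rfl⟩ : ∃ m, n = m + 1 := ⟨n - 1, by omega⟩
  have e : polySolution (m + 1) μ lam = fun y => lam / μ * y ^ (m + 1)
      + (lam - μ) / μ ^ (m + 1 + 1) * ((m + 1).factorial *
        ∑ j ∈ Finset.range (m + 1), (1 / (j.factorial : ℝ)) * μ ^ j * y ^ j) := by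
    funext x
    have h : ∑ j ∈ Finset.range (m + 1), ((m + 1).factorial : ℝ) / (j.factorial : ℝ) * μ ^ j * x ^ j
        = (m + 1).factorial *
          ∑ j ∈ Finset.range (m + 1), (1 / (j.factorial : ℝ)) * μ ^ j * x ^ j := by
      rw [Finset.mul_sum]
      exact Finset.sum_congr rfl fun j _ => by ring
    rw [polySolution, h]
  rw [e]
  refine (((hasDerivAt_pow (m + 1) y).const_mul (lam / μ)).add
    (((hasDerivAt_expSum m μ y).const_mul _).const_mul _)).congr_deriv ?_
  rw [Nat.factorial_succ]
  have : (m.factorial : ℝ) ≠ 0 := by positivity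
  push_cast
  field_simp
  ring

lemma polySolution_div {μ lam y : ℝ} (hn : 1 ≤ n) (hy : y ≠ 0) :
    polySolution n μ lam y / y ^ (n - 1) = lam / μ * y + (lam - μ) / μ ^ (n + 1) *
      ∑ j ∈ Finset.range n,
        (n.factorial : ℝ) / (j.factorial : ℝ) * μ ^ j * y ^ ((j : ℤ) + 1 - (n : ℤ)) := by
  have e : ∀ j : ℕ, y ^ ((j : ℤ) + 1 - (n : ℤ)) = y ^ j / y ^ (n - 1) := by
    intro j
    rw [show (j : ℤ) + 1 - n = (j : ℤ) - ((n - 1 : ℕ) : ℤ) by omega, zpow_sub₀ hy, zpow_natCast,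
      zpow_natCast]
  simp only [e, polySolution, add_div, mul_div_assoc, Finset.sum_div]
  congr 1
  · obtain ⟨m, rfl⟩ : ∃ m, n = m + 1 := ⟨n - 1, by omega⟩
    simp only [Nat.add_sub_cancel]
    field_simp
    ring

/-- The constant of integration in dimension at least two. -/
lemma exists_solution (hn : 2 ≤ n) {μ lam : ℝ} (hf : IsRadialKahlerPotential n f a b)
    (hμ : μ ≠ 0) (h : ∀ y ∈ yRange f a b,
      HasDerivAt (psiOfY f a b) ((μ - ((n : ℝ) - 1) / y) * psiOfY f a b y + n - lam * y) y) :
    ∃ ν : ℝ, ∀ y ∈ yRange f a b,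
      y ^ (n - 1) * psiOfY f a b y = ν * Real.exp (μ * y) + polySolution n μ lam y := by
  have hn1 : 1 ≤ n := by omega
  refine exists_eq_add_exp (u := fun y => y ^ (n - 1) * psiOfY f a b y)
    (q := fun y => (n - lam * y) * y ^ (n - 1)) (isOpen_yRange hn1 hf)
    (ordConnected_yRange hf).isPreconnected (fun y hy => ?_)
    (fun y _ => hasDerivAt_polySolution hn1 hμ y)
  have hy0 : y ≠ 0 := by
    obtain ⟨r, hr, rfl⟩ := hy
    exact (yFun_pos hn hf hr).ne'
  refine ((hasDerivAt_pow (n - 1) y).mul (h y hy)).congr_deriv ?_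
  obtain ⟨m, rfl⟩ : ∃ m, n = m + 2 := ⟨n - 2, by omega⟩
  simp only [show m + 2 - 1 = m + 1 by omega, Nat.add_sub_cancel]
  push_cast
  field_simp
  ring

end ODE

/-! ### Curvature in dimension one -/

section DimOne

variable {f : ℝ → ℝ} {a : ℝ} {b : EReal}

lemma radius_one (z : Cn 1) : (radius z : ℂ) = conj (z 0) * z 0 := by
  simp [radius, Complex.normSq_eq_conj_mul_self]

lemma radialMetric_one (hf : IsRadialKahlerPotential 1 f a b) {z : Cn 1} (hz : z ∈ shell 1 a b) :
    radialMetric 1 f z 0 0 = ((deriv (yFun f) (radius z) : ℝ) : ℂ) := by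
  rw [radialMetric_apply hf.smooth hz, ← radius_one, deriv_yFun hf.smooth hz]
  push_cast
  simp
  ring

lemma ricciMatrix_one (hf : IsRadialKahlerPotential 1 f a b) {z : Cn 1} (hz : z ∈ shell 1 a b) :
    ricciMatrix (radialMetric 1 f) z 0 0 = ((-(deriv (logDet 1 f) (radius z)
      + radius z * deriv (deriv (logDet 1 f)) (radius z)) : ℝ) : ℂ) := by
  rw [ricciMatrix_radial le_rfl hf hz, ← radius_one]
  push_cast
  simp
  ring

/-- On a Riemann surface the curvature tensor is the product of the metric and its Ricci form. -/
lemma curvature_one (hf : IsRadialKahlerPotential 1 f a b) {z : Cn 1} (hz : z ∈ shell 1 a b) :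
    curvature (radialMetric 1 f) z 0 0 0 0
      = ((deriv (yFun f) (radius z) * -(deriv (logDet 1 f) (radius z)
        + radius z * deriv (deriv (logDet 1 f)) (radius z)) : ℝ) : ℂ) := by
  have hG := (contDiffOn_yFun hf.smooth).deriv_interval
  have hev : (fun w => radialMetric 1 f w 0 0)
      =ᶠ[nhds z] fun w => ((deriv (yFun f) (radius w) : ℝ) : ℂ) := by
    filter_upwards [(isOpen_shell 1 a b).mem_nhds hz] with w hw
    exact radialMetric_one hf hw
  have hS := eventually_radius_mem hz
  have h1 := (hG.hasDerivAt_interval hz).hasDerivWithinAt (s := interval a b)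
  have e1 : dz 0 (dzbar 0 fun w => radialMetric 1 f w 0 0) z
      = ((deriv (deriv (yFun f)) (radius z) : ℝ) : ℂ)
        + ((deriv (deriv (deriv (yFun f))) (radius z) : ℝ) : ℂ) * radius z := by
    rw [dz_dzbar_congr hev]
    have h := complexHessian_radial_of_mem hG hz 0 0
    rw [← radius_one] at h
    simpa [complexHessian] using h
  have e2 : dz 0 (fun w => radialMetric 1 f w 0 0) z
      = ((deriv (deriv (yFun f)) (radius z) : ℝ) : ℂ) * conj (z 0) := by
    rw [dz_congr hev, dz_comp_radius hS h1]
  have e3 : dzbar 0 (fun w => radialMetric 1 f w 0 0) z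
      = ((deriv (deriv (yFun f)) (radius z) : ℝ) : ℂ) * z 0 := by
    rw [dzbar_congr hev, dzbar_comp_radius hS h1]
  have e4 : (radialMetric 1 f z)⁻¹ 0 0 = ((deriv (yFun f) (radius z) : ℝ) : ℂ)⁻¹ := by
    rw [Matrix.inv_def, Matrix.det_fin_one, radialMetric_one hf hz]
    simp
  have hpos := (deriv_yFun_pos le_rfl hf hz).ne'
  have hL1 : ∀ r ∈ interval a b,
      deriv (logDet 1 f) r = deriv (deriv (yFun f)) r / deriv (yFun f) r := by
    intro r hr
    rw [deriv_logDet le_rfl hf hr]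
    simp
  have hL2 : deriv (deriv (logDet 1 f)) (radius z)
      = (deriv (deriv (deriv (yFun f))) (radius z) * deriv (yFun f) (radius z)
        - deriv (deriv (yFun f)) (radius z) * deriv (deriv (yFun f)) (radius z))
          / deriv (yFun f) (radius z) ^ 2 := by
    have hev1 : deriv (logDet 1 f) =ᶠ[nhds (radius z)]
        fun r => deriv (deriv (yFun f)) r / deriv (yFun f) r :=
      Filter.eventually_of_mem ((isOpen_interval a b).mem_nhds hz) hL1
    rw [hev1.deriv_eq]
    exact ((hG.deriv_interval.hasDerivAt_interval hz).div (hG.hasDerivAt_interval hz) hpos).deriv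
  rw [curvature]
  simp only [Finset.univ_unique, Fin.default_eq_zero, Finset.sum_singleton, Fin.isValue]
  rw [e1, e2, e3, e4, hL1 _ hz, hL2]
  have hposC : ((deriv (yFun f) (radius z) : ℝ) : ℂ) ≠ 0 := by exact_mod_cast hpos
  have hr := radius_one z
  push_cast
  field_simp
  rw [hr]
  ring

/-- In this and the next two lemmas the Gaussian curvature is written, up to a constant factor, as a
function `K` of `r`. -/
lemma isKahlerEinstein_one_iff (hf : IsRadialKahlerPotential 1 f a b) {K : ℝ → ℝ}
    (hK : ∀ r ∈ interval a b, -(deriv (logDet 1 f) r + r * deriv (deriv (logDet 1 f)) r)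
      = K r * deriv (yFun f) r) :
    IsKahlerEinstein (radialMetric 1 f) (shell 1 a b) ↔ ∃ c, ∀ r ∈ interval a b, K r = c := by
  refine exists_congr fun c => ⟨fun h r hr => ?_, fun h z hz => ?_⟩
  · have hN := normSq_sqrt (hf.pos hr).le
    have hz : axisPoint 1 (Real.sqrt r : ℂ) ∈ shell 1 a b := axisPoint_mem (by rwa [hN])
    have h1 := congrFun (congrFun (h _ hz) 0) 0
    rw [Matrix.smul_apply, ricciMatrix_one hf hz, radialMetric_one hf hz, radius_axisPoint, hN,
      hK r hr, smul_eq_mul] at h1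
    exact mul_right_cancel₀ (deriv_yFun_pos le_rfl hf hr).ne' (by exact_mod_cast h1)
  · ext i j
    obtain rfl : i = 0 := Subsingleton.elim _ _
    obtain rfl : j = 0 := Subsingleton.elim _ _
    rw [Matrix.smul_apply, ricciMatrix_one hf hz, radialMetric_one hf hz, hK _ hz, h _ hz,
      smul_eq_mul, Complex.ofReal_mul]

lemma isFlat_one_iff (hf : IsRadialKahlerPotential 1 f a b) {K : ℝ → ℝ}
    (hK : ∀ r ∈ interval a b, -(deriv (logDet 1 f) r + r * deriv (deriv (logDet 1 f)) r)
      = K r * deriv (yFun f) r) :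
    IsFlat (radialMetric 1 f) (shell 1 a b) ↔ ∀ r ∈ interval a b, K r = 0 := by
  refine ⟨fun h r hr => ?_, fun h z hz i j k l => ?_⟩
  · have hN := normSq_sqrt (hf.pos hr).le
    have hz : axisPoint 1 (Real.sqrt r : ℂ) ∈ shell 1 a b := axisPoint_mem (by rwa [hN])
    have h1 := h _ hz 0 0 0 0
    rw [curvature_one hf hz, radius_axisPoint, hN, hK r hr, Complex.ofReal_eq_zero] at h1
    simpa [(deriv_yFun_pos le_rfl hf hr).ne'] using h1
  · obtain rfl : i = 0 := Subsingleton.elim _ _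
    obtain rfl : j = 0 := Subsingleton.elim _ _
    obtain rfl : k = 0 := Subsingleton.elim _ _
    obtain rfl : l = 0 := Subsingleton.elim _ _
    rw [curvature_one hf hz, hK _ hz, h _ hz]
    simp

lemma isComplexSpaceForm_one_iff (hf : IsRadialKahlerPotential 1 f a b) {K : ℝ → ℝ}
    (hK : ∀ r ∈ interval a b, -(deriv (logDet 1 f) r + r * deriv (deriv (logDet 1 f)) r)
      = K r * deriv (yFun f) r) :
    IsComplexSpaceForm (radialMetric 1 f) (shell 1 a b) ↔ ∃ c, ∀ r ∈ interval a b, K r = c := by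
  refine exists_congr fun c => ⟨fun h r hr => ?_, fun h z hz v => ?_⟩
  · have hN := normSq_sqrt (hf.pos hr).le
    have hz : axisPoint 1 (Real.sqrt r : ℂ) ∈ shell 1 a b := axisPoint_mem (by rwa [hN])
    have h1 := h _ hz (fun _ => 1)
    simp only [Finset.univ_unique, Fin.default_eq_zero, Finset.sum_singleton, Fin.isValue, map_one,
      mul_one] at h1
    rw [curvature_one hf hz, radialMetric_one hf hz, radius_axisPoint, hN, hK r hr] at h1
    have h2 : deriv (yFun f) r * (K r * deriv (yFun f) r) = c * deriv (yFun f) r ^ 2 := by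
      exact_mod_cast h1
    have hpos := (deriv_yFun_pos le_rfl hf hr).ne'
    exact mul_right_cancel₀ (pow_ne_zero 2 hpos) (by linarith)
  · simp only [Finset.univ_unique, Fin.default_eq_zero, Finset.sum_singleton, Fin.isValue]
    rw [curvature_one hf hz, radialMetric_one hf hz, hK _ hz, h _ hz]
    push_cast
    ring

end DimOne

/-! ### Curvature in dimension at least two -/

section HigherDim

variable {n : ℕ} {f : ℝ → ℝ} {a : ℝ} {b : EReal}

/-- A radial metric with `f'' = 0` is a constant multiple of the Euclidean metric. -/
lemma isFlat_of_deriv_deriv_eq_zero (hf : IsRadialKahlerPotential n f a b)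
    (h : ∀ r ∈ interval a b, deriv (deriv f) r = 0) :
    IsFlat (radialMetric n f) (shell n a b) := by
  obtain ⟨c, hc⟩ := (isOpen_interval a b).exists_is_const_of_deriv_eq_zero
    (isPreconnected_interval a b)
    (fun r hr => (hf.smooth.deriv_interval.hasDerivAt_interval
      hr).differentiableAt.differentiableWithinAt) (fun r hr => h r hr)
  have hev : ∀ z ∈ shell n a b, ∀ i j : Fin n, (fun w => radialMetric n f w i j)
      =ᶠ[nhds z] fun _ => (c : ℂ) * (if i = j then 1 else 0) := by
    intro z hz i j
    filter_upwards [(isOpen_shell n a b).mem_nhds hz] with w hw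
    rw [radialMetric_apply hf.smooth hw, h _ hw, hc _ hw]
    simp
  have e1 : ∀ (C : ℂ) (l : Fin n) (w : Cn n), dzbar l (fun _ => C) w = 0 := by
    intro C l w
    simp [dzbar]
  have e2 : ∀ (C : ℂ) (l : Fin n) (w : Cn n), dz l (fun _ => C) w = 0 := by
    intro C l w
    simp [dz]
  intro z hz i j k l
  rw [curvature, dz_dzbar_congr (hev z hz i j)]
  have e3 : (dzbar l fun _ : Cn n => (c : ℂ) * (if i = j then 1 else 0)) = fun _ => 0 :=
    funext fun w => e1 _ l w
  rw [e3, e2, neg_zero, zero_add]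
  refine Finset.sum_eq_zero fun p _ => Finset.sum_eq_zero fun q _ => ?_
  rw [dz_congr (hev z hz i q), e2, zero_mul, zero_mul]

lemma hasFDerivAt_normSq_coord (m : Fin n) (z : Cn n) :
    HasFDerivAt (fun w : Cn n => Complex.normSq (w m))
      ((2 * (z m).re) • (Complex.reCLM.comp (ContinuousLinearMap.proj (R := ℝ) m))
        + (2 * (z m).im) • (Complex.imCLM.comp (ContinuousLinearMap.proj (R := ℝ) m))) z := by
  have hre : HasFDerivAt (fun w : Cn n => (w m).re) _ z :=
    Complex.reCLM.hasFDerivAt.comp z (hasFDerivAt_coord m z)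
  have him : HasFDerivAt (fun w : Cn n => (w m).im) _ z :=
    Complex.imCLM.hasFDerivAt.comp z (hasFDerivAt_coord m z)
  have h3 : HasFDerivAt (fun w : Cn n => Complex.normSq (w m)) _ z :=
    (hre.mul hre).add (him.mul him)
  refine h3.congr_fderiv ?_
  ext u
  simp
  ring

lemma hasFDerivAt_conj_coord (m : Fin n) (z : Cn n) :
    HasFDerivAt (fun w : Cn n => conj (w m))
      ((Complex.conjCLE : ℂ →L[ℝ] ℂ).comp (ContinuousLinearMap.proj (R := ℝ) m)) z :=
  (Complex.conjCLE : ℂ →L[ℝ] ℂ).hasFDerivAt.comp z (hasFDerivAt_coord m z)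

/-- At a point with `z_m = 0`, the component of the curvature in the direction `e_m` is `-2 f''`:
there the first derivatives `∂g_{m q̄}/∂z_m` vanish. -/
lemma curvature_of_coord_eq_zero (hf : IsRadialKahlerPotential n f a b) {z : Cn n}
    (hz : z ∈ shell n a b) {m : Fin n} (hm : z m = 0) :
    curvature (radialMetric n f) z m m m m = -(2 * ((deriv (deriv f) (radius z) : ℝ) : ℂ)) := by
  have hs2 := hf.smooth.deriv_interval
  have hs3 := hs2.deriv_interval
  have hs4 := hs3.deriv_interval
  have hS := fun {w : Cn n} (hw : w ∈ shell n a b) => eventually_radius_mem hw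
  have e1 : ∀ q, dz m (fun w => radialMetric n f w m q) z = 0 := by
    intro q
    obtain ⟨δ, hδ⟩ : ∃ δ : ℂ, (if m = q then 1 else 0) = δ := ⟨_, rfl⟩
    have hev : (fun w => radialMetric n f w m q) =ᶠ[nhds z] fun w =>
        ((deriv f (radius w) : ℝ) : ℂ) * δ
          + ((deriv (deriv f) (radius w) : ℝ) : ℂ) * (conj (w m) * w q) := by
      filter_upwards [(isOpen_shell n a b).mem_nhds hz] with w hw
      rw [radialMetric_apply hf.smooth hw m q, hδ]
    have h1 := hasFDerivAt_ofReal_comp_radius (hS hz)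
      (hs2.hasDerivAt_interval hz).hasDerivWithinAt
    have h2 := hasFDerivAt_ofReal_comp_radius (hS hz)
      (hs3.hasDerivAt_interval hz).hasDerivWithinAt
    have h3 : HasFDerivAt (fun w : Cn n =>
        ((deriv f (radius w) : ℝ) : ℂ) * δ
          + ((deriv (deriv f) (radius w) : ℝ) : ℂ) * (conj (w m) * w q)) _ z :=
      (h1.mul_const _).add (h2.mul ((hasFDerivAt_conj_coord m z).mul (hasFDerivAt_coord q z)))
    rw [dz_congr hev, dz_of_hasFDerivAt h3]
    simp [radiusDeriv_single, hm]
    linear_combination (((deriv (deriv f) (radius z) : ℝ) : ℂ) * z q) * Complex.I_mul_I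
  have e2 : dz m (dzbar m fun w => radialMetric n f w m m) z
      = 2 * ((deriv (deriv f) (radius z) : ℝ) : ℂ) := by
    have hev : (fun w => dzbar m (fun w' => radialMetric n f w' m m) w) =ᶠ[nhds z] fun w =>
        ((2 * deriv (deriv f) (radius w)
          + deriv (deriv (deriv f)) (radius w) * Complex.normSq (w m) : ℝ) : ℂ) * w m := by
      filter_upwards [(isOpen_shell n a b).mem_nhds hz] with w hw
      have hev' : (fun w' => radialMetric n f w' m m) =ᶠ[nhds w] fun w' =>
          ((deriv f (radius w')
            + deriv (deriv f) (radius w') * Complex.normSq (w' m) : ℝ) : ℂ) := by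
        filter_upwards [(isOpen_shell n a b).mem_nhds hw] with x hx
        rw [radialMetric_apply hf.smooth hx, ← Complex.normSq_eq_conj_mul_self]
        push_cast
        simp
      have h1 := hasFDerivAt_comp_radius (hS hw) (hs2.hasDerivAt_interval hw).hasDerivWithinAt
      have h2 := hasFDerivAt_comp_radius (hS hw) (hs3.hasDerivAt_interval hw).hasDerivWithinAt
      have h3 : HasFDerivAt (fun w' : Cn n => ((deriv f (radius w')
            + deriv (deriv f) (radius w') * Complex.normSq (w' m) : ℝ) : ℂ)) _ w :=
        Complex.ofRealCLM.hasFDerivAt.comp w (h1.add (h2.mul (hasFDerivAt_normSq_coord m w)))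
      rw [dzbar_congr hev', dzbar_of_hasFDerivAt h3]
      simp only [ContinuousLinearMap.comp_apply, add_apply, smul_apply, radiusDeriv_single]
      apply Complex.ext <;> simp <;> ring
    have h1 := hasFDerivAt_comp_radius (hS hz) (hs3.hasDerivAt_interval hz).hasDerivWithinAt
    have h2 := hasFDerivAt_comp_radius (hS hz) (hs4.hasDerivAt_interval hz).hasDerivWithinAt
    have h3 : HasFDerivAt (fun w : Cn n => ((2 * deriv (deriv f) (radius w)
          + deriv (deriv (deriv f)) (radius w) * Complex.normSq (w m) : ℝ) : ℂ) * w m) _ z :=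
      (Complex.ofRealCLM.hasFDerivAt.comp z ((h1.const_mul 2).add
        (h2.mul (hasFDerivAt_normSq_coord m z)))).mul (hasFDerivAt_coord m z)
    rw [dz_congr hev, dz_of_hasFDerivAt h3]
    simp [hm]
    linear_combination (-(((deriv (deriv f) (radius z) : ℝ) : ℂ))) * Complex.I_mul_I
  rw [curvature, e2]
  simp [e1]

lemma isFlat_iff_deriv_deriv_eq_zero (hn : 2 ≤ n) (hf : IsRadialKahlerPotential n f a b) :
    IsFlat (radialMetric n f) (shell n a b) ↔ ∀ r ∈ interval a b, deriv (deriv f) r = 0 := by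
  refine ⟨fun h r hr => ?_, isFlat_of_deriv_deriv_eq_zero hf⟩
  have : NeZero n := ⟨by omega⟩
  have hN := normSq_sqrt (hf.pos hr).le
  have hz : axisPoint n (Real.sqrt r : ℂ) ∈ shell n a b := axisPoint_mem (by rwa [hN])
  have hm : (⟨1, by omega⟩ : Fin n) ≠ 0 := by simp [Fin.ext_iff]
  have h1 := h _ hz ⟨1, by omega⟩ ⟨1, by omega⟩ ⟨1, by omega⟩ ⟨1, by omega⟩
  rw [curvature_of_coord_eq_zero hf hz (axisPoint_of_ne hm), radius_axisPoint, hN] at h1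
  simpa using h1

/-- `f'' = 0` means `ψ = y`. -/
lemma deriv_deriv_eq_zero_iff (hf : IsRadialKahlerPotential n f a b) {r : ℝ}
    (hr : r ∈ interval a b) : deriv (deriv f) r = 0 ↔ psi f r = yFun f r := by
  have hr0 := (hf.pos hr).ne'
  rw [psi, yFun, deriv_yFun hf.smooth hr, mul_right_inj' hr0]
  simp [hr0]

/-- For `n ≥ 2` the metric is Kähler-Einstein iff `d/dr log det g` is a multiple of `f'`. -/
lemma isKahlerEinstein_iff (hn : 2 ≤ n) (hf : IsRadialKahlerPotential n f a b) :
    IsKahlerEinstein (radialMetric n f) (shell n a b)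
      ↔ ∃ c : ℝ, ∀ r ∈ interval a b, -deriv (logDet n f) r = c * deriv f r := by
  have : NeZero n := ⟨by omega⟩
  have hn1 : 1 ≤ n := by omega
  refine exists_congr fun c => ⟨fun h r hr => ?_, fun h z hz => ?_⟩
  · have hN := normSq_sqrt (hf.pos hr).le
    have hz : axisPoint n (Real.sqrt r : ℂ) ∈ shell n a b := axisPoint_mem (by rwa [hN])
    have hm : (⟨1, by omega⟩ : Fin n) ≠ 0 := by simp [Fin.ext_iff]
    have h1 := congrFun (congrFun (h _ hz) ⟨1, by omega⟩) ⟨1, by omega⟩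
    rw [Matrix.smul_apply, ricciMatrix_radial hn1 hf hz, radialMetric_apply hf.smooth hz,
      axisPoint_of_ne hm, radius_axisPoint, hN] at h1
    simp only [if_true, mul_one, map_zero, mul_zero, add_zero, smul_eq_mul] at h1
    exact_mod_cast h1
  · have h2 : -deriv (deriv (logDet n f)) (radius z) = c * deriv (deriv f) (radius z) := by
      have hev : (fun r => -deriv (logDet n f) r) =ᶠ[nhds (radius z)] fun r => c * deriv f r :=
        Filter.eventually_of_mem ((isOpen_interval a b).mem_nhds hz) h
      have h3 := hev.deriv_eq
      rwa [((contDiffOn_logDet hn1 hf).deriv_interval.hasDerivAt_interval hz).fun_neg.deriv,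
        ((hf.smooth.deriv_interval.hasDerivAt_interval hz).const_mul c).deriv] at h3
    have h1 : -((deriv (logDet n f) (radius z) : ℝ) : ℂ) = c * ((deriv f (radius z) : ℝ) : ℂ) := by
      exact_mod_cast h _ hz
    have h2' : -((deriv (deriv (logDet n f)) (radius z) : ℝ) : ℂ)
        = c * ((deriv (deriv f) (radius z) : ℝ) : ℂ) := by
      exact_mod_cast h2
    ext i j
    rw [Matrix.smul_apply, ricciMatrix_radial hn1 hf hz, radialMetric_apply hf.smooth hz,
      smul_eq_mul]
    linear_combination (if i = j then (1 : ℂ) else 0) * h1 + (conj (z i) * z j) * h2'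

end HigherDim

/-! ### Division by powers, primitives and inverse functions on the line -/

/-- Hadamard's lemma for an entire real-analytic function. -/
lemma exists_analytic_factor {f : ℝ → ℝ} (hf : ∀ x, AnalyticAt ℝ f x) (h0 : f 0 = 0) :
    ∃ g : ℝ → ℝ, (∀ x, AnalyticAt ℝ g x) ∧ ∀ x, f x = x * g x := by
  refine ⟨dslope f 0, fun x => ?_, fun x => ?_⟩
  · by_cases hx : x = 0
    · subst hx
      obtain ⟨p, hp⟩ := hf 0
      exact ⟨_, hp.has_fpower_series_dslope_fslope⟩
    · have h1 : dslope f 0 =ᶠ[nhds x] fun y => (y - 0)⁻¹ * (f y - f 0) := by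
        filter_upwards [isOpen_ne.mem_nhds hx] with y hy
        rw [dslope_of_ne f hy, slope_def_field, div_eq_inv_mul]
      refine AnalyticAt.congr ?_ h1.symm
      exact ((analyticAt_id.sub analyticAt_const).inv (by simpa using hx)).mul
        ((hf x).sub analyticAt_const)
  · have := sub_smul_dslope f 0 x
    simpa [h0] using this.symm

lemma exists_primitive {V : Set ℝ} (hV : IsOpen V) (hV' : V.OrdConnected) {u : ℝ → ℝ}
    (hu : ContDiffOn ℝ ∞ u V) {x₀ : ℝ} (hx₀ : x₀ ∈ V) (c : ℝ) :
    ∃ F : ℝ → ℝ, F x₀ = c ∧ (∀ x ∈ V, HasDerivAt F (u x) x) ∧ ContDiffOn ℝ ∞ F V := by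
  have hd : ∀ x ∈ V, HasDerivAt (fun x => c + ∫ t in x₀..x, u t) (u x) x := by
    intro x hx
    refine HasDerivAt.const_add c (intervalIntegral.integral_hasDerivAt_right ?_ ?_ ?_)
    · exact (hu.continuousOn.mono (hV'.uIcc_subset hx₀ hx)).intervalIntegrable
    · exact ContinuousAt.stronglyMeasurableAtFilter hV
        (fun y hy => hu.continuousOn.continuousAt (hV.mem_nhds hy)) x hx
    · exact hu.continuousOn.continuousAt (hV.mem_nhds hx)
  refine ⟨_, by simp, hd, ?_⟩
  rw [contDiffOn_infty_iff_deriv_of_isOpen hV]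
  exact ⟨fun x hx => (hd x hx).differentiableAt.differentiableWithinAt,
    hu.congr fun x hx => (hd x hx).deriv⟩

/-- The inverse of a smooth function with positive derivative on an interval. -/
lemma exists_smooth_inverse {D : Set ℝ} (hD : IsOpen D) (hD' : D.OrdConnected) {R R' : ℝ → ℝ}
    (hR : ContDiffOn ℝ ∞ R D) (hR' : ∀ y ∈ D, HasDerivAt R (R' y) y) (hpos : ∀ y ∈ D, 0 < R' y) :
    ∃ Y : ℝ → ℝ, IsOpen (R '' D) ∧ (R '' D).OrdConnected ∧ ContDiffOn ℝ ∞ Y (R '' D) ∧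
      ∀ y ∈ D, Y (R y) = y ∧ HasDerivAt Y (R' y)⁻¹ (R y) := by
  have hmono : StrictMonoOn R D := by
    refine strictMonoOn_of_deriv_pos hD'.convex hR.continuousOn fun x hx => ?_
    rw [hD.interior_eq] at hx
    rw [(hR' x hx).deriv]
    exact hpos x hx
  have hstrict : ∀ y ∈ D, HasStrictDerivAt R (R' y) y := fun y hy =>
    (hR.contDiffAt (hD.mem_nhds hy)).hasStrictDerivAt' (hR' y hy) (by simp)
  have hopen : IsOpen (R '' D) := by
    rw [isOpen_iff_mem_nhds]
    rintro _ ⟨y, hy, rfl⟩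
    rw [← (hstrict y hy).map_nhds_eq (hpos y hy).ne']
    exact Filter.image_mem_map (hD.mem_nhds hy)
  have hinv : ∀ y ∈ D, Function.invFunOn R D (R y) = y := fun y hy =>
    hmono.injOn.leftInvOn_invFunOn hy
  have hder : ∀ y ∈ D, HasStrictDerivAt (Function.invFunOn R D) (R' y)⁻¹ (R y) := fun y hy =>
    (hstrict y hy).to_local_left_inverse (hpos y hy).ne'
      (Filter.eventually_of_mem (hD.mem_nhds hy) hinv)
  refine ⟨Function.invFunOn R D, hopen,
    (hD'.isPreconnected.image _ hR.continuousOn).ordConnected, ?_,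
    fun y hy => ⟨hinv y hy, (hder y hy).hasDerivAt⟩⟩
  rintro _ ⟨y, hy, rfl⟩
  have hsm := hR.contDiffAt (hD.mem_nhds hy)
  have hf' : HasFDerivAt R ((ContinuousLinearEquiv.unitsEquivAut ℝ
      (Units.mk0 (R' y) (hpos y hy).ne') : ℝ ≃L[ℝ] ℝ) : ℝ →L[ℝ] ℝ) y := by
    refine (hR' y hy).hasFDerivAt.congr_fderiv ?_
    ext
    simp
  have hloc := hsm.to_localInverse hf' (by simp)
  refine (hloc.congr_of_eventuallyEq ?_).contDiffWithinAt
  exact (hsm.hasStrictFDerivAt' hf' (by simp)).localInverse_unique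
    (Filter.eventually_of_mem (hD.mem_nhds hy) hinv)

/-! ### The solutions which vanish to order `n` at `y = 0` -/

/-- An analytic solution of `Q' = μ Q + (n - λ y) yⁿ⁻¹` with `Q(0) = 0` is `yⁿ (1 + y κ(y))`:
comparing the coefficients of `yʲ⁻¹` shows inductively that `Q` is divisible by `yⁿ`. -/
lemma exists_factor_of_ode {n : ℕ} (hn : 1 ≤ n) {μ lam : ℝ} {Q : ℝ → ℝ}
    (hQa : ∀ y, AnalyticAt ℝ Q y) (hQ0 : Q 0 = 0)
    (hQ : ∀ y, HasDerivAt Q (μ * Q y + (n - lam * y) * y ^ (n - 1)) y) :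
    ∃ κ : ℝ → ℝ, (∀ y, AnalyticAt ℝ κ y) ∧ ∀ y, Q y = y ^ n * (1 + y * κ y) := by
  have hcoeff : ∀ j ≤ n, ∀ Θ : ℝ → ℝ, (∀ y, AnalyticAt ℝ Θ y) → (∀ y, Q y = y ^ j * Θ y) →
      j * Θ 0 = n * 0 ^ (n - j) := by
    intro j hj Θ hΘ h
    have hd : ∀ y, HasDerivAt Θ (deriv Θ y) y := fun y => (hΘ y).differentiableAt.hasDerivAt
    have hW : (fun y => j * Θ y + y * deriv Θ y - μ * y * Θ y - (n - lam * y) * y ^ (n - j))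
        = fun _ => 0 := by
      refine Continuous.ext_on (dense_compl_singleton (0 : ℝ)) ?_ continuous_const ?_
      · have c1 : Continuous Θ := continuous_iff_continuousAt.2 fun y => (hΘ y).continuousAt
        have c2 : Continuous (deriv Θ) :=
          continuous_iff_continuousAt.2 fun y => (hΘ y).deriv.continuousAt
        fun_prop
      · intro y hy
        have e1 := (hQ y).unique
          (((hasDerivAt_pow j y).mul (hd y)).congr_of_eventuallyEq
            (Filter.Eventually.of_forall h))
        rw [h y] at e1
        have e2 : (j : ℝ) * y ^ (j - 1) * y = j * y ^ j := by
          rcases j with _ | j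
          · simp
          · simp [pow_succ, mul_assoc]
        have e3 : y ^ (n - 1) * y = y ^ j * y ^ (n - j) := by
          rw [← pow_add, ← pow_succ]
          congr 1
          omega
        have hy0 : y ^ j ≠ 0 := pow_ne_zero _ hy
        refine mul_left_cancel₀ hy0 ?_
        simp only [mul_zero]
        linear_combination (-y) * e1 - Θ y * e2 + (n - lam * y) * e3
    have := congrFun hW 0
    simp only [zero_mul, mul_zero, sub_zero, add_zero] at this
    linarith
  have hind : ∀ j ≤ n, ∃ Θ : ℝ → ℝ, (∀ y, AnalyticAt ℝ Θ y) ∧ ∀ y, Q y = y ^ j * Θ y := by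
    intro j
    induction j with
    | zero => exact fun _ => ⟨Q, hQa, fun y => by simp⟩
    | succ j ih =>
      intro hj
      obtain ⟨Θ, hΘ, h⟩ := ih (by omega)
      have h0 : Θ 0 = 0 := by
        rcases Nat.eq_zero_or_pos j with rfl | hj0
        · have := h 0
          simpa [hQ0] using this.symm
        · have := hcoeff j (by omega) Θ hΘ h
          rw [zero_pow (by omega), mul_zero] at this
          have hj' : (j : ℝ) ≠ 0 := by positivity
          simpa [hj'] using this
      obtain ⟨g, hg, hg'⟩ := exists_analytic_factor hΘ h0
      exact ⟨g, hg, fun y => by rw [h, hg', pow_succ, mul_assoc]⟩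
  obtain ⟨Θ, hΘ, h⟩ := hind n le_rfl
  have h1 : Θ 0 = 1 := by
    have := hcoeff n le_rfl Θ hΘ h
    have hn' : (n : ℝ) ≠ 0 := by positivity
    simpa [hn'] using this
  obtain ⟨κ, hκ, hκ'⟩ := exists_analytic_factor (f := fun y => Θ y - 1)
    (fun y => (hΘ y).sub analyticAt_const) (by simp [h1])
  exact ⟨κ, hκ, fun y => by rw [h, ← hκ']; ring⟩

/-- The derivative of `e^{-μ y} Q` is `(n - λ y) yⁿ⁻¹ e^{-μ y}`, whose sign on `y > 0` changes at
most once, from plus to minus. So the set of `y > 0` with `Q(y) > 0` is an interval starting at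
`0`. -/
lemma pos_of_ode {n : ℕ} (hn : 1 ≤ n) {μ lam : ℝ} {Q : ℝ → ℝ} (hQ0 : Q 0 = 0)
    (hQ : ∀ y, HasDerivAt Q (μ * Q y + (n - lam * y) * y ^ (n - 1)) y) {s t : ℝ} (hs : 0 < s)
    (hst : s ≤ t) (ht : 0 < Q t) : 0 < Q s := by
  have hd : ∀ y, HasDerivAt (fun y => Q y * Real.exp (-(μ * y)))
      ((n - lam * y) * y ^ (n - 1) * Real.exp (-(μ * y))) y := by
    intro y
    refine ((hQ y).mul ((hasDerivAt_id y).const_mul μ).neg.exp).congr_deriv ?_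
    simp
    ring
  have hcont : Continuous fun y => Q y * Real.exp (-(μ * y)) :=
    continuous_iff_continuousAt.2 fun y => (hd y).continuousAt
  have hn0 : (0 : ℝ) < n := by exact_mod_cast hn
  suffices h : 0 < Q s * Real.exp (-(μ * s)) from (pos_iff_pos_of_mul_pos h).2 (Real.exp_pos _)
  rcases le_or_gt (lam * s) n with h | h
  · have hm : StrictMonoOn (fun y => Q y * Real.exp (-(μ * y))) (Set.Icc 0 s) := by
      refine strictMonoOn_of_deriv_pos (convex_Icc 0 s) hcont.continuousOn fun x hx => ?_
      rw [interior_Icc] at hx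
      rw [(hd x).deriv]
      have hx0 : 0 < x := hx.1
      have : 0 < n - lam * x := by
        rcases le_or_gt lam 0 with hl | hl
        · nlinarith
        · nlinarith [hx.2]
      positivity
    simpa [hQ0] using hm ⟨le_rfl, hs.le⟩ ⟨hs.le, le_rfl⟩ hs
  · have hl : 0 < lam := by
      by_contra hl
      nlinarith
    have hm : AntitoneOn (fun y => Q y * Real.exp (-(μ * y))) (Set.Icc s t) := by
      refine antitoneOn_of_deriv_nonpos (convex_Icc s t) hcont.continuousOn
        (fun x _ => (hd x).differentiableAt.differentiableWithinAt) fun x hx => ?_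
      rw [interior_Icc] at hx
      rw [(hd x).deriv]
      have hx0 : 0 < x := hs.trans hx.1
      have h1 : n - lam * x ≤ 0 := by nlinarith [hx.1]
      exact mul_nonpos_of_nonpos_of_nonneg
        (mul_nonpos_of_nonpos_of_nonneg h1 (by positivity)) (Real.exp_pos _).le
    exact (mul_pos ht (Real.exp_pos _)).trans_le (hm ⟨le_rfl, hst⟩ ⟨hst, le_rfl⟩ hst)

/-! ### Extension to the origin -/

section Origin

variable {n : ℕ} {f : ℝ → ℝ} {a : ℝ} {b : EReal}

/-- The profile `y` satisfies `r y' = y Θ(y)` with `Θ = 1 + y κ(y)`. With a primitive `K` of `κ/Θ`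
this says that `y e^{-K(y)}` is a constant multiple of `r`. The left hand side is smooth with
positive derivative `e^{-K}/Θ` also near `y = 0`, so that its inverse function `Y` extends `y` to a
neighbourhood of `[0, b)`, and so does `Y(r)/r`, a constant multiple of `e^{K(Y(r))}`. -/
lemma exists_extension (hn : 1 ≤ n) (hf : IsPositiveRadialPotential n f a b) {μ lam : ℝ}
    {Q : ℝ → ℝ} (hQa : ∀ y, AnalyticAt ℝ Q y) (hQ0 : Q 0 = 0)
    (hQ : ∀ y, HasDerivAt Q (μ * Q y + (n - lam * y) * y ^ (n - 1)) y)
    (hψ : ∀ r ∈ interval a b, yFun f r ^ (n - 1) * psi f r = Q (yFun f r)) :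
    ∃ (F : ℝ → ℝ) (V : Set ℝ), IsOpen V ∧ {x : ℝ | 0 ≤ x ∧ (x : EReal) < b} ⊆ V ∧
      ContDiffOn ℝ ∞ F V ∧ Set.EqOn F f (interval a b) ∧
      ∀ x ∈ V, 0 < deriv F x ∧ 0 < deriv F x + x * deriv (deriv F) x := by
  obtain ⟨hf, hy⟩ := hf
  obtain ⟨κ, hκ, hfac⟩ := exists_factor_of_ode hn hQa hQ0 hQ
  set Θ : ℝ → ℝ := fun y => 1 + y * κ y with hΘdef
  have hκc : ContDiff ℝ ∞ κ := contDiff_iff_contDiffAt.2 fun y => (hκ y).contDiffAt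
  have hΘc : ContDiff ℝ ∞ Θ := contDiff_const.add (contDiff_id.mul hκc)
  have hyI := contDiffOn_yFun hf.smooth
  have hΘy : ∀ r ∈ interval a b, ∀ s, 0 < s → s ≤ yFun f r → 0 < Θ s := by
    intro r hr s hs hsr
    have h1 : 0 < Q (yFun f r) := by
      rw [← hψ r hr]
      exact mul_pos (pow_pos (hy r hr) _) (psi_pos hn hf hr)
    have h2 := pos_of_ode hn hQ0 hQ hs hsr h1
    rw [hfac] at h2
    exact (pos_iff_pos_of_mul_pos h2).1 (pow_pos hs n)
  obtain ⟨δ, hδ, hΘδ⟩ : ∃ δ > 0, ∀ s, -δ < s → s ≤ 0 → 0 < Θ s := by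
    have h0 : 0 < Θ 0 := by simp [hΘdef]
    obtain ⟨δ, hδ, h⟩ := Metric.eventually_nhds_iff.1
      (hΘc.continuous.continuousAt.eventually (lt_mem_nhds h0))
    refine ⟨δ, hδ, fun s hs hs0 => h ?_⟩
    rw [Real.dist_eq, sub_zero, abs_lt]
    constructor <;> linarith
  -- an open interval containing `0` and all values of `y`, on which `Θ` is positive
  set D : Set ℝ := {s | -δ < s ∧ ∃ r ∈ interval a b, s < yFun f r} with hDdef
  have hD : IsOpen D := by
    have : D = Set.Ioi (-δ) ∩ ⋃ r ∈ interval a b, Set.Iio (yFun f r) := by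
      ext s
      simp [hDdef]
    rw [this]
    exact isOpen_Ioi.inter (isOpen_biUnion fun _ _ => isOpen_Iio)
  have hD' : D.OrdConnected := ⟨fun s hs t ht x hx =>
    ⟨hs.1.trans_le hx.1, ht.2.imp fun r hr => ⟨hr.1, hx.2.trans_lt hr.2⟩⟩⟩
  obtain ⟨r₀, hr₀⟩ := nonempty_interval hf.lt
  have h0D : (0 : ℝ) ∈ D := ⟨by linarith, r₀, hr₀, hy r₀ hr₀⟩
  have hyD : ∀ r ∈ interval a b, yFun f r ∈ D := by
    intro r hr
    obtain ⟨s, hs, hrs⟩ := exists_lt_mem_interval hr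
    exact ⟨by linarith [hy r hr], s, hs, strictMonoOn_yFun hn hf hr hs hrs⟩
  have hΘD : ∀ s ∈ D, 0 < Θ s := by
    rintro s ⟨hs, r, hr, hsr⟩
    rcases le_or_gt s 0 with h | h
    · exact hΘδ s hs h
    · exact hΘy r hr s h hsr.le
  obtain ⟨K, hK0, hK, hKc⟩ := exists_primitive hD hD' (u := fun s => κ s / Θ s)
    (hκc.contDiffOn.div hΘc.contDiffOn fun s hs => (hΘD s hs).ne') h0D 0
  have hR : ∀ s ∈ D, HasDerivAt (fun s => s * Real.exp (-K s)) (Real.exp (-K s) / Θ s) s := by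
    intro s hs
    refine ((hasDerivAt_id s).mul (hK s hs).fun_neg.exp).congr_deriv ?_
    have := (hΘD s hs).ne'
    simp only [id]
    field_simp
    simp only [hΘdef]
    ring
  have hode : ∀ r ∈ interval a b, r * deriv (yFun f) r = yFun f r * Θ (yFun f r) := by
    intro r hr
    have h1 := hψ r hr
    have h2 : yFun f r ^ n = yFun f r ^ (n - 1) * yFun f r := by
      rw [← pow_succ]
      congr 1
      omega
    rw [hfac, h2, mul_assoc] at h1
    exact mul_left_cancel₀ (pow_pos (hy r hr) _).ne' h1
  obtain ⟨c, hc⟩ : ∃ c, ∀ r ∈ interval a b, yFun f r * Real.exp (-K (yFun f r)) / r = c := by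
    have hd : ∀ r ∈ interval a b,
        HasDerivAt (fun r => yFun f r * Real.exp (-K (yFun f r)) / r) 0 r := by
      intro r hr
      have hr0 := (hf.pos hr).ne'
      refine (((hR _ (hyD r hr)).comp r (hyI.hasDerivAt_interval hr)).div (hasDerivAt_id r)
        hr0).congr_deriv ?_
      have h1 := hode r hr
      have h2 := (hΘD _ (hyD r hr)).ne'
      simp only [id, Function.comp_apply]
      field_simp
      linear_combination Real.exp (-K (yFun f r)) * h1
    exact (isOpen_interval a b).exists_is_const_of_deriv_eq_zero (isPreconnected_interval a b)
      (fun r hr => (hd r hr).differentiableAt.differentiableWithinAt) fun r hr => (hd r hr).deriv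
  have hc0 : 0 < c := by
    rw [← hc r₀ hr₀]
    exact div_pos (mul_pos (hy r₀ hr₀) (Real.exp_pos _)) (hf.pos hr₀)
  set R : ℝ → ℝ := fun s => c⁻¹ * (s * Real.exp (-K s)) with hRdef
  have hRy : ∀ r ∈ interval a b, R (yFun f r) = r := by
    intro r hr
    have hr0 := (hf.pos hr).ne'
    simp only [hRdef]
    rw [← hc r hr]
    have h1 := (hy r hr).ne'
    have h2 := (Real.exp_pos (-K (yFun f r))).ne'
    field_simp
  have hRc : ContDiffOn ℝ ∞ R D := contDiffOn_const.mul (contDiffOn_id.mul hKc.neg.exp)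
  have hR' : ∀ s ∈ D, HasDerivAt R (c⁻¹ * (Real.exp (-K s) / Θ s)) s := fun s hs =>
    (hR s hs).const_mul _
  have hRpos : ∀ s ∈ D, 0 < c⁻¹ * (Real.exp (-K s) / Θ s) := fun s hs =>
    mul_pos (inv_pos.2 hc0) (div_pos (Real.exp_pos _) (hΘD s hs))
  obtain ⟨Y, hV, hV', hYc, hY⟩ := exists_smooth_inverse hD hD' hRc hR' hRpos
  set V := R '' D with hVdef
  have hsub : {x : ℝ | 0 ≤ x ∧ (x : EReal) < b} ⊆ V := by
    rintro x ⟨hx0, hxb⟩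
    obtain ⟨r, hr, hxr⟩ : ∃ r ∈ interval a b, x ≤ r := by
      rcases le_or_gt x r₀ with h | h
      · exact ⟨r₀, hr₀, h⟩
      · exact ⟨x, ⟨hr₀.1.trans h, hxb⟩, le_rfl⟩
    have h1 := (hV'.out (x := R 0) (y := R (yFun f r)) ⟨0, h0D, rfl⟩ ⟨_, hyD r hr, rfl⟩)
    refine h1 ⟨?_, ?_⟩
    · simpa [hRdef] using hx0
    · rwa [hRy r hr]
  have hYD : ∀ x ∈ V, Y x ∈ D := by
    rintro _ ⟨s, hs, rfl⟩
    rwa [(hY s hs).1]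
  have huc : ContDiffOn ℝ ∞ (fun x => c * Real.exp (K (Y x))) V :=
    contDiffOn_const.mul (hKc.comp hYc hYD).exp
  have hIV : interval a b ⊆ V := fun r hr => hsub ⟨(hf.pos hr).le, hr.2⟩
  obtain ⟨F, hF0, hF, hFc⟩ := exists_primitive hV hV' huc (hIV hr₀) (f r₀)
  have hYu : ∀ x ∈ V, Y x = x * (c * Real.exp (K (Y x))) := by
    rintro _ ⟨s, hs, rfl⟩
    rw [(hY s hs).1]
    simp only [hRdef, Real.exp_neg]
    have := (Real.exp_pos (K s)).ne'
    have := hc0.ne'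
    field_simp
  have hFd : ∀ x ∈ V, deriv F x = c * Real.exp (K (Y x)) := fun x hx => (hF x hx).deriv
  refine ⟨F, V, hV, hsub, hFc, ?_, fun x hx => ⟨?_, ?_⟩⟩
  · refine (isOpen_interval a b).eqOn_of_deriv_eq (isPreconnected_interval a b)
      (hFc.mono hIV |>.differentiableOn (by simp)) (hf.smooth.differentiableOn (by simp)) ?_ hr₀ hF0
    intro r hr
    have h1 := hYu r (hIV hr)
    have h2 : Y r = yFun f r := by
      rw [← (hY _ (hyD r hr)).1, hRy r hr]
    have h3 : r * (c * Real.exp (K (Y r))) = r * deriv f r := by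
      rw [← h1, h2, yFun]
    rw [hFd r (hIV hr)]
    exact mul_left_cancel₀ (hf.pos hr).ne' h3
  · rw [hFd x hx]
    exact mul_pos hc0 (Real.exp_pos _)
  · have hud : HasDerivAt (deriv F) (deriv (deriv F) x) x :=
      (((hFc.deriv_of_isOpen (m := ∞) hV (by simp)).contDiffAt (hV.mem_nhds hx)).differentiableAt
        (by simp)).hasDerivAt
    have h1 : HasDerivAt Y (1 * deriv F x + x * deriv (deriv F) x) x := by
      refine ((hasDerivAt_id x).mul hud).congr_of_eventuallyEq ?_
      filter_upwards [hV.mem_nhds hx] with t ht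
      rw [Pi.mul_apply, hFd t ht]
      exact hYu t ht
    obtain ⟨s, hs, rfl⟩ := hx
    have h2 := h1.unique (hY s hs).2
    rw [one_mul] at h2
    rw [h2]
    exact inv_pos.2 (hRpos s hs)

lemma posDef_of_extension {F : ℝ → ℝ} {V : Set ℝ} (hV : IsOpen V) (hF : ContDiffOn ℝ ∞ F V)
    (hpos : ∀ x ∈ V, 0 < deriv F x ∧ 0 < deriv F x + x * deriv (deriv F) x) {z : Cn n}
    (hz : radius z ∈ V) : (radialMetric n F z).PosDef := by
  have h1 : ∀ x ∈ V, HasDerivAt F (deriv F x) x := fun x hx =>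
    ((hF.contDiffAt (hV.mem_nhds hx)).differentiableAt (by simp)).hasDerivAt
  have h2 : HasDerivAt (deriv F) (deriv (deriv F) (radius z)) (radius z) :=
    (((hF.deriv_of_isOpen (m := ∞) hV (by simp)).contDiffAt (hV.mem_nhds hz)).differentiableAt
      (by simp)).hasDerivAt
  exact posDef_of_radial (complexHessian_radial (continuous_radius.continuousAt (hV.mem_nhds hz))
    (fun x hx => (h1 x hx).hasDerivWithinAt) h2.hasDerivWithinAt) (hpos _ hz).1 (hpos _ hz).2

/-- A maximal solution whose function `yⁿ⁻¹ ψ(y)` vanishes at `y = 0` closes up smoothly at the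
origin: the extension of its potential to `[0, b)` shows that `a = 0` by maximality. -/
lemma isDefinedAtOrigin_of_ode (hn : 1 ≤ n) (hmax : IsMaximalPotential n f a b) {μ lam : ℝ}
    {Q : ℝ → ℝ} (hQa : ∀ y, AnalyticAt ℝ Q y) (hQ0 : Q 0 = 0)
    (hQ : ∀ y, HasDerivAt Q (μ * Q y + (n - lam * y) * y ^ (n - 1)) y)
    (hψ : ∀ r ∈ interval a b, yFun f r ^ (n - 1) * psi f r = Q (yFun f r)) :
    IsDefinedAtOrigin n f a b := by
  obtain ⟨F, V, hV, hsub, hFc, hEq, hpos⟩ := exists_extension hn hmax.1 hQa hQ0 hQ hψ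
  have hf := hmax.1.1
  have hsub0 : interval 0 b ⊆ V := fun x hx => hsub ⟨hx.1.le, hx.2⟩
  have hpot : IsPositiveRadialPotential n F 0 b :=
    ⟨⟨le_rfl, (EReal.coe_le_coe_iff.2 hf.nonneg).trans_lt hf.lt, hFc.mono hsub0,
      fun z hz => posDef_of_extension hV hFc hpos (hsub0 hz)⟩,
      fun r hr => mul_pos hr.1 (hpos r (hsub0 hr)).1⟩
  have ha := (hmax.2 F 0 b hf.nonneg le_rfl hpot hEq).1
  exact ⟨ha.symm, F, hFc.mono hsub, hEq, fun z hz =>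
    posDef_of_extension hV hFc hpos (hsub ⟨radius_nonneg z, hz⟩)⟩

lemma interval_mem_nhdsGT {b : EReal} (hb : (0 : EReal) < b) :
    interval 0 b ∈ nhdsWithin (0 : ℝ) (Set.Ioi 0) := by
  have : {x : ℝ | (x : EReal) < b} ∈ nhds (0 : ℝ) :=
    (isOpen_lt continuous_coe_real_ereal continuous_const).mem_nhds hb
  filter_upwards [self_mem_nhdsWithin, mem_nhdsWithin_of_mem_nhds this] with x hx hx'
  exact ⟨hx, hx'⟩

/-- The one-sided derivatives at `0` of the extended potential; its first derivative is the metric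
at the origin. -/
lemma IsDefinedAtOrigin.exists_limits (hn : 1 ≤ n) (hb : (0 : EReal) < b)
    (h : IsDefinedAtOrigin n f a b) :
    a = 0 ∧ ∃ p q t : ℝ, 0 < p ∧ Filter.Tendsto (deriv f) (nhdsWithin 0 (Set.Ioi 0)) (nhds p) ∧
      Filter.Tendsto (deriv (deriv f)) (nhdsWithin 0 (Set.Ioi 0)) (nhds q) ∧
      Filter.Tendsto (deriv (deriv (deriv f))) (nhdsWithin 0 (Set.Ioi 0)) (nhds t) := by
  have : NeZero n := ⟨by omega⟩
  obtain ⟨rfl, F, hF, hEq, hpos⟩ := h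
  refine ⟨rfl, ?_⟩
  set S : Set ℝ := {x | 0 ≤ x ∧ (x : EReal) < b} with hS
  have hI : interval 0 b ⊆ S := fun x hx => ⟨hx.1.le, hx.2⟩
  have hSconv : Convex ℝ S := by
    have : S.OrdConnected := ⟨fun x hx y hy z hz =>
      ⟨hx.1.trans hz.1, (EReal.coe_le_coe_iff.2 hz.2).trans_lt hy.2⟩⟩
    exact this.convex
  have hu : UniqueDiffOn ℝ S := by
    refine uniqueDiffOn_convex hSconv ?_
    exact (nonempty_interval hb).mono (interior_maximal hI (isOpen_interval 0 b))
  have h0 : (0 : ℝ) ∈ S := ⟨le_rfl, hb⟩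
  have hIn := interval_mem_nhdsGT hb
  have hD : ∀ {g G : ℝ → ℝ}, Set.EqOn G g (interval 0 b) →
      Set.EqOn (derivWithin G S) (deriv g) (interval 0 b) := by
    intro g G hGg x hx
    have hxn := (isOpen_interval 0 b).mem_nhds hx
    rw [derivWithin_of_mem_nhds (Filter.mem_of_superset hxn hI)]
    have hev : G =ᶠ[nhds x] g := Filter.eventually_of_mem hxn hGg
    exact hev.deriv_eq
  have hlim : ∀ {g G : ℝ → ℝ}, ContDiffOn ℝ ∞ G S → Set.EqOn G g (interval 0 b) →
      Filter.Tendsto g (nhdsWithin 0 (Set.Ioi 0)) (nhds (G 0)) := by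
    intro g G hG hGg
    have h1 : Filter.Tendsto G (nhdsWithin 0 (interval 0 b)) (nhds (G 0)) :=
      (hG.continuousOn 0 h0).mono_left (nhdsWithin_mono _ hI)
    have h2 := h1.mono_left (nhdsWithin_le_iff.2 hIn)
    refine h2.congr' ?_
    filter_upwards [hIn] with x hx
    exact hGg hx
  have hF1 : ContDiffOn ℝ ∞ (derivWithin F S) S := hF.derivWithin hu (by simp)
  have hF2 : ContDiffOn ℝ ∞ (derivWithin (derivWithin F S) S) S := hF1.derivWithin hu (by simp)
  have hF3 : ContDiffOn ℝ ∞ (derivWithin (derivWithin (derivWithin F S) S) S) S :=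
    hF2.derivWithin hu (by simp)
  refine ⟨_, _, _, ?_, hlim hF1 (hD hEq), hlim hF2 (hD (hD hEq)), hlim hF3 (hD (hD (hD hEq)))⟩
  have hr0 : radius (0 : Cn n) = 0 := by simp [radius]
  have hpd := (hpos 0 (by rw [hr0]; exact hb)).diag_pos (i := 0)
  have hSev : ∀ᶠ w in nhds (0 : Cn n), radius w ∈ S := by
    have : {x : ℝ | (x : EReal) < b} ∈ nhds (radius (0 : Cn n)) :=
      (isOpen_lt continuous_coe_real_ereal continuous_const).mem_nhds (by rw [hr0]; exact hb)
    filter_upwards [continuous_radius.continuousAt this] with w hw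
    exact ⟨radius_nonneg w, hw⟩
  have hdw : ∀ {G : ℝ → ℝ}, ContDiffOn ℝ ∞ G S → ∀ x ∈ S,
      HasDerivWithinAt G (derivWithin G S x) S x := fun hG x hx =>
    (hG.differentiableOn (by simp) x hx).hasDerivWithinAt
  rw [radialMetric, complexHessian_radial hSev (hdw hF) (hdw hF1 _ (by rw [hr0]; exact h0)),
    hr0] at hpd
  simpa using hpd

/-- The behaviour of `y`, `ψ` and their derivatives at the origin. -/
lemma IsDefinedAtOrigin.tendsto (hn : 1 ≤ n) (hf : IsRadialKahlerPotential n f a b)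
    (h : IsDefinedAtOrigin n f a b) :
    interval a b ∈ nhdsWithin (0 : ℝ) (Set.Ioi 0) ∧
    Filter.Tendsto (yFun f) (nhdsWithin 0 (Set.Ioi 0)) (nhds 0) ∧
    Filter.Tendsto (psi f) (nhdsWithin 0 (Set.Ioi 0)) (nhds 0) ∧
    ∃ p : ℝ, 0 < p ∧ Filter.Tendsto (deriv (yFun f)) (nhdsWithin 0 (Set.Ioi 0)) (nhds p) ∧
      Filter.Tendsto (deriv (psi f)) (nhdsWithin 0 (Set.Ioi 0)) (nhds p) := by
  have hb : (0 : EReal) < b := (EReal.coe_le_coe_iff.2 hf.nonneg).trans_lt hf.lt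
  obtain ⟨rfl, p, q, t, hp0, hp, hq, ht⟩ := h.exists_limits hn hb
  have hI := interval_mem_nhdsGT hb
  have hid : Filter.Tendsto (fun r : ℝ => r) (nhdsWithin 0 (Set.Ioi 0)) (nhds 0) :=
    nhdsWithin_le_nhds
  have hy' : Filter.Tendsto (deriv (yFun f)) (nhdsWithin 0 (Set.Ioi 0)) (nhds p) := by
    have h1 := hp.add (hid.mul hq)
    rw [zero_mul, add_zero] at h1
    refine h1.congr' ?_
    filter_upwards [hI] with r hr
    exact (deriv_yFun hf.smooth hr).symm
  refine ⟨hI, ?_, ?_, p, hp0, hy', ?_⟩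
  · have h1 := hid.mul hp
    rwa [zero_mul] at h1
  · have h1 := hid.mul hy'
    rwa [zero_mul] at h1
  · have h1 := hy'.add (hid.mul ((hq.const_mul 2).add (hid.mul ht)))
    rw [zero_mul, add_zero] at h1
    refine h1.congr' ?_
    filter_upwards [hI] with r hr
    rw [deriv_psi hf.smooth hr, deriv_deriv_yFun hf.smooth hr]

lemma IsDefinedAtOrigin.apply_zero (hn : 1 ≤ n) (hf : IsRadialKahlerPotential n f a b)
    (h : IsDefinedAtOrigin n f a b) {Q : ℝ → ℝ} (hQ : Continuous Q)
    (hψ : ∀ r ∈ interval a b, yFun f r ^ (n - 1) * psi f r = Q (yFun f r)) : Q 0 = 0 := by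
  obtain ⟨hI, hy, hp, -⟩ := h.tendsto hn hf
  have h1 := (hy.pow (n - 1)).mul hp
  rw [mul_zero] at h1
  refine tendsto_nhds_unique ((hQ.tendsto 0).comp hy) (h1.congr' ?_)
  filter_upwards [hI] with r hr
  exact hψ r hr

/-- At the origin `dψ/dy = 1`, since both `ψ'` and `y'` tend to `f'(0) > 0`. -/
lemma IsDefinedAtOrigin.eq_zero_of_ode {f : ℝ → ℝ} (hf : IsRadialKahlerPotential 1 f a b)
    (h : IsDefinedAtOrigin 1 f a b) {μ k lam : ℝ}
    (hode : ∀ r ∈ interval a b,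
      deriv (psi f) r = (μ * psi f r + k + 1 - lam * yFun f r) * deriv (yFun f) r) : k = 0 := by
  obtain ⟨hI, hy, hp, p, hp0, hy', hp'⟩ := h.tendsto le_rfl hf
  have h1 := ((((hp.const_mul μ).add_const k).add_const 1).sub (hy.const_mul lam)).mul hy'
  have h2 := tendsto_nhds_unique hp' (h1.congr' (by
    filter_upwards [hI] with r hr
    exact (hode r hr).symm))
  have h3 : k * p = 0 := by linarith
  exact (mul_eq_zero.1 h3).resolve_right hp0.ne'

/-- A maximal potential with `yⁿ⁻¹ ψ = ν e^{μ y} + P(y)`, where `P` is `polySolution`, is defined at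
the origin iff the right hand side vanishes at `y = 0`. -/
lemma isDefinedAtOrigin_iff (hn : 1 ≤ n) (hmax : IsMaximalPotential n f a b) {μ lam ν : ℝ}
    (hμ : μ ≠ 0)
    (hψ : ∀ r ∈ interval a b, yFun f r ^ (n - 1) * psi f r
      = ν * Real.exp (μ * yFun f r) + polySolution n μ lam (yFun f r)) :
    IsDefinedAtOrigin n f a b ↔ ν = n.factorial * (μ - lam) / μ ^ (n + 1) := by
  have h0 : ν * Real.exp (μ * 0) + polySolution n μ lam 0 = 0
      ↔ ν = n.factorial * (μ - lam) / μ ^ (n + 1) := by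
    have h1 : polySolution n μ lam 0 = (lam - μ) / μ ^ (n + 1) * n.factorial := by
      rw [polySolution, zero_pow (by omega), Finset.sum_eq_single 0]
      · simp
      · intro j _ hj
        simp [hj]
      · intro h
        simp at h
        omega
    rw [h1, mul_zero, Real.exp_zero, mul_one, add_eq_zero_iff_eq_neg]
    ring_nf
  have hQd : ∀ y, HasDerivAt (fun y => ν * Real.exp (μ * y) + polySolution n μ lam y)
      (μ * (ν * Real.exp (μ * y) + polySolution n μ lam y) + (n - lam * y) * y ^ (n - 1)) y := by
    intro y
    refine (((((hasDerivAt_id y).const_mul μ).exp).const_mul ν).add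
      (hasDerivAt_polySolution hn hμ y)).congr_deriv ?_
    simp only [id]
    ring
  rw [← h0]
  refine ⟨fun h => h.apply_zero hn hmax.1.1
    (continuous_iff_continuousAt.2 fun y => (hQd y).continuousAt) hψ, fun h => ?_⟩
  refine isDefinedAtOrigin_of_ode hn hmax (fun y => ?_) h hQd hψ
  unfold polySolution
  fun_prop

end Origin

/-! ### Trivial solitons -/

section Trivial

variable {n : ℕ} {f : ℝ → ℝ} {a : ℝ} {b : EReal}

/-- In dimension one the curvature of the soliton is `λ - μ dψ/dy`. -/
lemma curvature_of_ode_one {f : ℝ → ℝ} (hf : IsRadialKahlerPotential 1 f a b) {μ k lam : ℝ}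
    (hode : ∀ r ∈ interval a b,
      deriv (psi f) r = (μ * psi f r + k + 1 - lam * yFun f r) * deriv (yFun f) r) :
    ∀ r ∈ interval a b, -(deriv (logDet 1 f) r + r * deriv (deriv (logDet 1 f)) r)
      = (lam - μ * (μ * psi f r + k + 1 - lam * yFun f r)) * deriv (yFun f) r := by
  have h1 : ∀ r ∈ interval a b,
      r * deriv (logDet 1 f) r = μ * psi f r + k - lam * yFun f r := by
    intro r hr
    have hy := (deriv_yFun_pos le_rfl hf hr).ne'
    rw [mul_deriv_logDet le_rfl hf hr, hode r hr, mul_div_cancel_right₀ _ hy]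
    push_cast
    ring
  intro r hr
  have hev : (fun r => μ * psi f r + k - lam * yFun f r) =ᶠ[nhds r]
      fun r => r * deriv (logDet 1 f) r :=
    Filter.eventually_of_mem ((isOpen_interval a b).mem_nhds hr) fun x hx => (h1 x hx).symm
  have h2 := ((hasDerivAt_id r).mul
    ((contDiffOn_logDet le_rfl hf).deriv_interval.hasDerivAt_interval hr)).congr_of_eventuallyEq hev
  have h3 := (((((contDiffOn_psi hf.smooth).hasDerivAt_interval hr).const_mul μ).add_const k).sub
    (((contDiffOn_yFun hf.smooth).hasDerivAt_interval hr).const_mul lam)).unique h2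
  simp only [id, one_mul] at h3
  rw [← h3, hode r hr]
  ring

/-- `e^{μ y}` is not constant. -/
lemma exists_const_exp_iff (hn : 1 ≤ n) (hf : IsRadialKahlerPotential n f a b) {μ ν : ℝ}
    (hμ : μ ≠ 0) :
    (∃ c, ∀ r ∈ interval a b, -(μ ^ 2 * ν * Real.exp (μ * yFun f r)) = c) ↔ ν = 0 := by
  refine ⟨?_, fun h => ⟨0, fun r _ => by simp [h]⟩⟩
  rintro ⟨c, hc⟩
  obtain ⟨r, hr, s, hs, hrs⟩ := not_const_yFun hn hf
  have h1 : (μ ^ 2 * ν) * (Real.exp (μ * yFun f s) - Real.exp (μ * yFun f r)) = 0 := by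
    linarith [hc r hr, hc s hs]
  have h2 : Real.exp (μ * yFun f s) - Real.exp (μ * yFun f r) ≠ 0 := by
    rw [sub_ne_zero, Ne, Real.exp_eq_exp]
    exact fun h => hrs.ne' (mul_left_cancel₀ hμ h)
  simpa [hμ] using (mul_eq_zero.1 h1).resolve_right h2

lemma mul_deriv_logDet_of_ode (hn : 2 ≤ n) (hf : IsRadialKahlerPotential n f a b) {μ lam : ℝ}
    (hode : ∀ r ∈ interval a b, deriv (psi f) r
      = ((μ - ((n : ℝ) - 1) / yFun f r) * psi f r + n - lam * yFun f r) * deriv (yFun f) r) :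
    ∀ r ∈ interval a b, r * deriv (logDet n f) r = μ * psi f r - lam * yFun f r := by
  intro r hr
  have hn1 : 1 ≤ n := by omega
  have hy := (deriv_yFun_pos hn1 hf hr).ne'
  have hy0 := (yFun_pos hn hf hr).ne'
  rw [mul_deriv_logDet hn1 hf hr, hode r hr, mul_div_cancel_right₀ _ hy]
  field_simp
  ring

/-- A Kähler-Einstein soliton with `μ ≠ 0` has `ψ = α y` with a constant `α`; the equation for `ψ`
then reads `n (α - 1) = (μ α - λ) y`, so that `α = 1`. -/
lemma psi_eq_yFun_of_isKahlerEinstein (hn : 2 ≤ n) (hf : IsRadialKahlerPotential n f a b)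
    {μ lam : ℝ} (hμ : μ ≠ 0)
    (hode : ∀ r ∈ interval a b, deriv (psi f) r
      = ((μ - ((n : ℝ) - 1) / yFun f r) * psi f r + n - lam * yFun f r) * deriv (yFun f) r)
    (hKE : IsKahlerEinstein (radialMetric n f) (shell n a b)) :
    ∀ r ∈ interval a b, psi f r = yFun f r := by
  have hn1 : 1 ≤ n := by omega
  obtain ⟨c, hc⟩ := (isKahlerEinstein_iff hn hf).1 hKE
  have h1 : ∀ r ∈ interval a b, psi f r = (lam - c) / μ * yFun f r := by
    intro r hr
    have h2 := mul_deriv_logDet_of_ode hn hf hode r hr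
    have h3 : μ * psi f r = (lam - c) * yFun f r := by
      have h4 : yFun f r = r * deriv f r := rfl
      linear_combination (-1) * h2 - r * hc r hr + c * h4
    field_simp
    linarith
  set α := (lam - c) / μ
  have h2 : ∀ r ∈ interval a b, n * (α - 1) = (μ * α - lam) * yFun f r := by
    intro r hr
    have hy := (deriv_yFun_pos hn1 hf hr).ne'
    have hy0 := (yFun_pos hn hf hr).ne'
    have hev : psi f =ᶠ[nhds r] fun r => α * yFun f r :=
      Filter.eventually_of_mem ((isOpen_interval a b).mem_nhds hr) h1
    have h3 : deriv (psi f) r = α * deriv (yFun f) r := by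
      rw [hev.deriv_eq]
      exact (((contDiffOn_yFun hf.smooth).hasDerivAt_interval hr).const_mul α).deriv
    have h4 := hode r hr
    rw [h3, h1 r hr] at h4
    have h5 := mul_right_cancel₀ hy h4
    field_simp at h5
    linear_combination h5
  obtain ⟨r, hr, s, hs, hrs⟩ := not_const_yFun hn1 hf
  have h3 : (μ * α - lam) * (yFun f s - yFun f r) = 0 := by
    linarith [h2 r hr, h2 s hs]
  have h4 : μ * α - lam = 0 := (mul_eq_zero.1 h3).resolve_right (sub_ne_zero.2 hrs.ne')
  have h5 := h2 r hr
  rw [h4, zero_mul] at h5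
  have hn0 : (n : ℝ) ≠ 0 := by positivity
  have h6 : α = 1 := by
    have := (mul_eq_zero.1 h5).resolve_left hn0
    linarith
  intro t ht
  rw [h1 t ht, h6, one_mul]

lemma isKahlerEinstein_iff_isFlat (hn : 2 ≤ n) (hf : IsRadialKahlerPotential n f a b)
    {μ lam : ℝ} (hμ : μ ≠ 0)
    (hode : ∀ r ∈ interval a b, deriv (psi f) r
      = ((μ - ((n : ℝ) - 1) / yFun f r) * psi f r + n - lam * yFun f r) * deriv (yFun f) r) :
    IsKahlerEinstein (radialMetric n f) (shell n a b)
      ↔ IsFlat (radialMetric n f) (shell n a b) := by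
  have hn1 : 1 ≤ n := by omega
  rw [isFlat_iff_deriv_deriv_eq_zero hn hf]
  refine ⟨fun h r hr => (deriv_deriv_eq_zero_iff hf hr).2
    (psi_eq_yFun_of_isKahlerEinstein hn hf hμ hode h r hr), fun h => ?_⟩
  refine (isKahlerEinstein_iff hn hf).2 ⟨0, fun r hr => ?_⟩
  have h1 : ∀ r ∈ interval a b, psi f r = yFun f r := fun r hr =>
    (deriv_deriv_eq_zero_iff hf hr).1 (h r hr)
  have hev : psi f =ᶠ[nhds r] yFun f :=
    Filter.eventually_of_mem ((isOpen_interval a b).mem_nhds hr) h1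
  have h2 := mul_deriv_logDet hn1 hf hr
  rw [hev.deriv_eq, h1 r hr, div_self (deriv_yFun_pos hn1 hf hr).ne',
    div_self (yFun_pos hn hf hr).ne', sub_self, mul_zero, add_zero] at h2
  rw [(mul_eq_zero.1 h2).resolve_left (hf.pos hr).ne', neg_zero, zero_mul]

lemma isFlat_iff_of_solution (hn : 2 ≤ n) (hf : IsRadialKahlerPotential n f a b)
    {μ lam ν : ℝ} (hμ : μ ≠ 0)
    (hode : ∀ r ∈ interval a b, deriv (psi f) r
      = ((μ - ((n : ℝ) - 1) / yFun f r) * psi f r + n - lam * yFun f r) * deriv (yFun f) r)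
    (hψ : ∀ r ∈ interval a b, yFun f r ^ (n - 1) * psi f r
      = ν * Real.exp (μ * yFun f r) + polySolution n μ lam (yFun f r)) :
    IsFlat (radialMetric n f) (shell n a b) ↔ ν = 0 ∧ μ = lam := by
  have hn1 : 1 ≤ n := by omega
  have hpoly : ∀ y : ℝ, μ = lam → polySolution n μ lam y = y ^ (n - 1) * y := by
    rintro y rfl
    rw [polySolution, sub_self, zero_div, zero_mul, add_zero, div_self hμ, one_mul, ← pow_succ]
    congr 1
    omega
  rw [isFlat_iff_deriv_deriv_eq_zero hn hf]
  constructor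
  · intro h
    have h1 : ∀ r ∈ interval a b, psi f r = yFun f r := fun r hr =>
      (deriv_deriv_eq_zero_iff hf hr).1 (h r hr)
    obtain ⟨r, hr⟩ := nonempty_interval hf.lt
    have hy := (deriv_yFun_pos hn1 hf hr).ne'
    have hy0 := (yFun_pos hn hf hr).ne'
    have hev : psi f =ᶠ[nhds r] yFun f :=
      Filter.eventually_of_mem ((isOpen_interval a b).mem_nhds hr) h1
    have h2 := hode r hr
    rw [hev.deriv_eq, h1 r hr] at h2
    have h3 := mul_right_cancel₀ hy ((one_mul _).trans h2)
    have h4 : (μ - lam) * yFun f r = 0 := by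
      field_simp at h3
      linear_combination -h3
    have h5 : μ = lam := sub_eq_zero.1 ((mul_eq_zero.1 h4).resolve_right hy0)
    have h6 := hψ r hr
    rw [hpoly _ h5, h1 r hr] at h6
    have h7 : ν * Real.exp (μ * yFun f r) = 0 := by linarith
    exact ⟨(mul_eq_zero.1 h7).resolve_right (Real.exp_pos _).ne', h5⟩
  · rintro ⟨h1, h2⟩ r hr
    have h3 := hψ r hr
    rw [h1, zero_mul, zero_add, hpoly _ h2] at h3
    exact (deriv_deriv_eq_zero_iff hf hr).2
      (mul_left_cancel₀ (pow_pos (yFun_pos hn hf hr) _).ne' h3)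

end Trivial

end RadialKRS

open RadialKRS in
theorem proposition2p2 (n : ℕ) (lam : ℝ) (f : ℝ → ℝ) (rinf : ℝ) (rsup : EReal)
    (X : Cn n → Cn n)
    (hf : IsRadialKahlerPotential n f rinf rsup)
    (hX : IsSoliton (radialMetric n f) X lam (shell n rinf rsup)) :
    (n = 1 →
      (∃ μ k : ℝ, ∀ y ∈ yRange f rinf rsup,
        HasDerivAt (psiOfY f rinf rsup) (μ * psiOfY f rinf rsup y + k + 1 - lam * y) y) ∧
      ∀ μ k : ℝ,
        (∀ y ∈ yRange f rinf rsup,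
          HasDerivAt (psiOfY f rinf rsup) (μ * psiOfY f rinf rsup y + k + 1 - lam * y) y) →
        (μ = 0 →
          IsKahlerEinstein (radialMetric n f) (shell n rinf rsup) ∧
          IsComplexSpaceForm (radialMetric n f) (shell n rinf rsup)) ∧
        (μ ≠ 0 → ∃ ν : ℝ,
          (∀ y ∈ yRange f rinf rsup,
            psiOfY f rinf rsup y
              = ν * Real.exp (μ * y) + lam / μ * y + (lam / μ ^ 2 - (k + 1) / μ)) ∧
          (IsKahlerEinstein (radialMetric n f) (shell n rinf rsup) ↔
            IsFlat (radialMetric n f) (shell n rinf rsup)) ∧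
          (IsComplexSpaceForm (radialMetric n f) (shell n rinf rsup) ↔
            IsFlat (radialMetric n f) (shell n rinf rsup)) ∧
          (IsFlat (radialMetric n f) (shell n rinf rsup) ↔ ν = 0) ∧
          (IsMaximalPotential n f rinf rsup →
            (IsDefinedAtOrigin n f rinf rsup ↔ k = 0 ∧ ν = (μ - lam) / μ ^ 2)))) ∧
    (2 ≤ n →
      (∃ μ : ℝ, ∀ y ∈ yRange f rinf rsup,
        HasDerivAt (psiOfY f rinf rsup)
          ((μ - ((n : ℝ) - 1) / y) * psiOfY f rinf rsup y + n - lam * y) y) ∧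
      ∀ μ : ℝ,
        (∀ y ∈ yRange f rinf rsup,
          HasDerivAt (psiOfY f rinf rsup)
            ((μ - ((n : ℝ) - 1) / y) * psiOfY f rinf rsup y + n - lam * y) y) →
        (μ = 0 → IsKahlerEinstein (radialMetric n f) (shell n rinf rsup)) ∧
        (μ ≠ 0 → ∃ ν : ℝ,
          (∀ y ∈ yRange f rinf rsup,
            psiOfY f rinf rsup y
              = ν * Real.exp (μ * y) / y ^ (n - 1) + lam / μ * y
                + (lam - μ) / μ ^ (n + 1) *
                  ∑ j ∈ Finset.range n,
                    (n.factorial : ℝ) / (j.factorial : ℝ) * μ ^ j * y ^ ((j : ℤ) + 1 - (n : ℤ))) ∧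
          (IsKahlerEinstein (radialMetric n f) (shell n rinf rsup) ↔
            IsFlat (radialMetric n f) (shell n rinf rsup)) ∧
          (IsFlat (radialMetric n f) (shell n rinf rsup) ↔ ν = 0 ∧ μ = lam) ∧
          (IsMaximalPotential n f rinf rsup →
            (IsDefinedAtOrigin n f rinf rsup ↔
              ν = (n.factorial : ℝ) * (μ - lam) / μ ^ (n + 1))))) := by
  refine ⟨?_, fun hn => ?_⟩
  · rintro rfl
    refine ⟨hX.exists_ode_one hf, fun μ k h => ?_⟩
    have hode : ∀ r ∈ interval rinf rsup,
        deriv (psi f) r = (μ * psi f r + k + 1 - lam * yFun f r) * deriv (yFun f) r := by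
      intro r hr
      rw [← psiOfY_yFun le_rfl hf hr, ← hasDerivAt_psiOfY_iff le_rfl hf hr]
      exact h _ ⟨r, hr, rfl⟩
    have hK := curvature_of_ode_one hf hode
    refine ⟨?_, fun hμ => ?_⟩
    · rintro rfl
      rw [isKahlerEinstein_one_iff hf hK, isComplexSpaceForm_one_iff hf hK]
      exact ⟨⟨lam, fun r _ => by simp⟩, ⟨lam, fun r _ => by simp⟩⟩
    · obtain ⟨ν, hν⟩ := exists_solution_one hf hμ h
      have hψ : ∀ r ∈ interval rinf rsup, psi f r
          = ν * Real.exp (μ * yFun f r) + lam / μ * yFun f r + (lam / μ ^ 2 - (k + 1) / μ) := by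
        intro r hr
        rw [← psiOfY_yFun le_rfl hf hr]
        exact hν _ ⟨r, hr, rfl⟩
      have hK' : ∀ r ∈ interval rinf rsup,
          -(deriv (logDet 1 f) r + r * deriv (deriv (logDet 1 f)) r)
            = -(μ ^ 2 * ν * Real.exp (μ * yFun f r)) * deriv (yFun f) r := by
        intro r hr
        rw [hK r hr, hψ r hr]
        congr 1
        field_simp
        ring
      have hflat : IsFlat (radialMetric 1 f) (shell 1 rinf rsup) ↔ ν = 0 := by
        rw [isFlat_one_iff hf hK']
        exact ⟨fun h => (exists_const_exp_iff le_rfl hf hμ).1 ⟨0, h⟩, fun h r _ => by simp [h]⟩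
      refine ⟨ν, hν, ?_, ?_, hflat, fun hmax => ?_⟩
      · rw [hflat, isKahlerEinstein_one_iff hf hK', exists_const_exp_iff le_rfl hf hμ]
      · rw [hflat, isComplexSpaceForm_one_iff hf hK', exists_const_exp_iff le_rfl hf hμ]
      · have hiff : k = 0 → (IsDefinedAtOrigin 1 f rinf rsup ↔ ν = (μ - lam) / μ ^ 2) := by
          rintro rfl
          rw [isDefinedAtOrigin_iff le_rfl hmax hμ (lam := lam) (ν := ν)]
          · simp
          · intro r hr
            rw [hψ r hr, polySolution]
            simp
            field_simp
            ring
        refine ⟨fun hd => ?_, fun hk => (hiff hk.1).2 hk.2⟩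
        have hk := hd.eq_zero_of_ode hf hode
        exact ⟨hk, (hiff hk).1 hd⟩
  · have hn1 : 1 ≤ n := by omega
    refine ⟨hX.exists_ode hn hf, fun μ h => ?_⟩
    have hode : ∀ r ∈ interval rinf rsup, deriv (psi f) r
        = ((μ - ((n : ℝ) - 1) / yFun f r) * psi f r + n - lam * yFun f r) * deriv (yFun f) r := by
      intro r hr
      rw [← psiOfY_yFun hn1 hf hr, ← hasDerivAt_psiOfY_iff hn1 hf hr]
      exact h _ ⟨r, hr, rfl⟩
    refine ⟨?_, fun hμ => ?_⟩
    · rintro rfl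
      refine (isKahlerEinstein_iff hn hf).2 ⟨lam, fun r hr => ?_⟩
      have h1 := mul_deriv_logDet_of_ode hn hf hode r hr
      refine mul_left_cancel₀ (hf.pos hr).ne' ?_
      have h2 : yFun f r = r * deriv f r := rfl
      linear_combination (-1) * h1 + lam * h2
    · obtain ⟨ν, hν⟩ := exists_solution hn hf hμ h
      have hψ : ∀ r ∈ interval rinf rsup, yFun f r ^ (n - 1) * psi f r
          = ν * Real.exp (μ * yFun f r) + polySolution n μ lam (yFun f r) := by
        intro r hr
        rw [← psiOfY_yFun hn1 hf hr]
        exact hν _ ⟨r, hr, rfl⟩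
      refine ⟨ν, ?_, isKahlerEinstein_iff_isFlat hn hf hμ hode,
        isFlat_iff_of_solution hn hf hμ hode hψ, fun hmax => isDefinedAtOrigin_iff hn1 hmax hμ hψ⟩
      rintro _ ⟨r, hr, rfl⟩
      have hy0 := (yFun_pos hn hf hr).ne'
      rw [add_assoc, ← polySolution_div hn1 hy0, ← add_div, ← hν _ ⟨r, hr, rfl⟩,
        mul_div_cancel_left₀ _ (pow_ne_zero _ hy0)]
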